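/- **Setting.** Let $(Z_{1i},Z_{2i},R_i)$, $i\ge 1$, be i.i.d. copies of $(Z_1,Z_2,R)$ with $Z_1\in\mathbb R^d$, $Z_2\in\mathbb R$, $R\in\{0,1\}$, and suppose the outcome is missing at random: $\Pr(R=1\mid Z_2,Z_1)=\pi_0(Z_1)$ with $\pi_0(Z_1)>0$ a.s. Let $\mathcal B\subset\mathbb R\times(0,\infty)$ be the parameter space of $\beta=(\mu,\sigma)'$ and let $\beta_0=(\mu_0,\sigma_0)'$ be the true value. Let $\psi_{c_\mu},\psi_{c_\sigma}:\mathbb R\to\mathbb R$ be measurable (in robust estimation, bounded and odd), and put $A=E\,\psi_{c_\mu}(\sigma_0^{-1}(Z_2-\mu_0))$, $B=E\,\psi_{c_\sigma}^2(\sigma_0^{-1}(Z_2-\mu_0))$, $$m_\psi(Z_2;\beta)=\big(\psi_{c_\mu}(\sigma^{-1}(Z_2-\mu))-A,\ \psi_{c_\sigma}^2(\sigma^{-1}(Z_2-\mu))-B\big)'.$$ Let $\pi(Z_1;\gamma)>0$, $\gamma\in\mathbb R^p$, be a propensity model and $h(Z_1;\beta,\xi)=(h_1,h_2)'$, $\xi\in\mathbb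 R^q$, a working model for $E(m_\psi(Z_2;\beta)\mid Z_1)$, and define $$\varphi(Z,R;\beta,\gamma,\xi)=\frac{R}{\pi(Z_1;\gamma)}m_\psi(Z_2;\beta)-\frac{R-\pi(Z_1;\gamma)}{\pi(Z_1;\gamma)}h(Z_1;\beta,\xi).$$ Given estimators $\hat\gamma,\hat\xi$, the robust augmented IPW estimator $\hat\beta=(\hat\mu,\hat\sigma)'$ is, with probability tending to one, a minimizer over $\beta\in\mathcal B$ of $\hat Q(\beta;\hat\gamma,\hat\xi)=\big\|n^{-1}\sum_{i=1}^n\varphi(Z_i,R_i;\beta,\hat\gamma,\hat\xi)\big\|^2$ (in particular, a solution in $\mathcal B$ of $\sum_i\varphi(Z_i,R_i;\beta,\hat\gamma,\hat\xi)=0$). All functions are jointly Borel measurable. Assume (A.1) $\hat\gamma\to\gamma^*$ and $\hat\xi\to\xi^*$ in probability, and that at least one model is correctly specified: $\Pr(R=1\mid Z_1)=\pi(Z_1;\gamma^*)$ a.s., or, for every $\beta\in\mathcal B$, $m_\psi(Z_2;\beta)$ is integrable and $h(Z_1;\beta,\xi^*)=E(m_\psi(Z_2;\beta)\mid Z_1)$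 a.s. **(Consistency.)** Suppose in addition: - (A.2) there are open neighbourhoods $U$ of $\gamma^*$ and $V$ of $\xi^*$ such that, almost surely, $\pi(Z_1;\cdot)$ is $C^1$ on $U$ and $h(Z_1;\beta,\cdot)$ is $C^1$ on $V$ for all $\beta\in\mathcal B$, and $E\sup_{\mathcal B\times U\times V}\|\partial\varphi/\partial\gamma'\|<\infty$, $E\sup_{\mathcal B\times U\times V}\|\partial\varphi/\partial\xi'\|<\infty$; - (A.3) $\mathcal B$ is compact, $\beta_0\in\mathcal B$, and $E\,m_\psi(Z_2;\beta)=0$ with $\beta\in\mathcal B$ only for $\beta=\beta_0$; - (A.4) for some $\varepsilon>0$, $1\ge\pi(Z_1;\gamma^*)>\varepsilon$ a.s.; - (A.5)–(A.6) for each $\beta\in\mathcal B$, almost surely $\psi_{c_\mu}(\sigma^{-1}(Z_2-\mu))$, $\psi_{c_\sigma}(\sigma^{-1}(Z_2-\mu))$ and $h(Z_1;\cdot,\xi^*)$ are, as functions on $\mathcal B$, continuous at $\beta$; - (A.7)–(A.8) $\sup_{\beta\in\mathcal B}|\psi_{c_\mu}(\sigma^{-1}(Z_2-\mu))|^2$,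 $\sup_{\beta\in\mathcal B}|\psi_{c_\sigma}^2(\sigma^{-1}(Z_2-\mu))|^2$ and $\sup_{\beta\in\mathcal B}h_j(Z_1;\beta,\xi^*)^2$ $(j=1,2)$ have finite expectation. Then $\hat\beta\to\beta_0$ in probability. **(Asymptotic normality.)** Suppose that $\hat\beta\to\beta_0$ in probability and that, with probability tending to one, $\sum_{i=1}^n m_\gamma(R_i,Z_{1i};\hat\gamma)=0$ and $\sum_{i=1}^nR_i\,m_\xi(Z_i;\hat\xi)=0$, where $m_\gamma$ is $\mathbb R^p$-valued and $m_\xi$ is $\mathbb R^q$-valued. Let $\tilde\varphi(\theta)$, $\theta=(\beta',\gamma',\xi')'$, stack $\varphi(Z,R;\beta,\gamma,\xi)$, $m_\gamma(R,Z_1;\gamma)$ and $R\,m_\xi(Z;\xi)$, put $\theta_0=(\beta_0',\gamma^{*\prime},\xi^{*\prime})'$, and suppose: - (A.9) $\theta_0$ is interior to $\mathcal B\times\mathbb R^p\times\mathbb R^q$; - (A.10) $E\,\tilde\varphi(\theta_0)=0$ and $E\|\tilde\varphi(\theta_0)\|^2<\infty$; - (A.11)–(A.12) there is an open neighbourhood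 $\mathcal N$ of $\theta_0$ on which $\tilde\varphi$ is a.s. $C^1$, with $E\sup_{\theta\in\mathcal N}\|\nabla_\theta\tilde\varphi(\theta)\|<\infty$; - (A.13) $E\{\nabla_\theta\tilde\varphi(\theta_0)\}'E\{\nabla_\theta\tilde\varphi(\theta_0)\}$ is nonsingular; - $m_\psi(Z_2;\cdot)$ is a.s. differentiable at $\beta_0$ with integrable derivative (so that the expectation below exists). Then $\sqrt n(\hat\beta-\beta_0)\overset{d}\to N\big(0,E[IF\,IF']\big)$, where, with all derivatives taken at $(\beta_0,\gamma^*,\xi^*)$, $$IF=-\Big\{E\Big[\frac{\partial m_\psi}{\partial\beta'}\Big]\Big\}^{-1}\Big\{\varphi(Z,R;\beta_0,\gamma^*,\xi^*)-E\Big[\frac{\partial\varphi}{\partial\gamma'}\Big]\Big\{E\Big[\frac{\partial m_\gamma}{\partial\gamma'}\Big]\Big\}^{-1}m_\gamma(R,Z_1;\gamma^*)-E\Big[\frac{\partial\varphi}{\partial\xi'}\Big]\Big\{E\Big[R\frac{\partial m_\xi}{\partial\xi'}\Big]\Big\}^{-1}R\,m_\xi(Z;\xi^*)\Big\}.$$ 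-/

import Mathlib

open MeasureTheory ProbabilityTheory Filter Topology

noncomputable section

namespace RobustAIPW

/-- `ℝᵏ` with its Euclidean norm. -/
abbrev Vec (k : ℕ) : Type := EuclideanSpace ℝ (Fin k)

/-- One complete observation `(Z₁, Z₂, R)`: covariate vector, scalar outcome, observation status. -/
abbrev Obs (d : ℕ) : Type := (Fin d → ℝ) × ℝ × Bool

/-- The covariates `Z₁`. -/
def z1 {d : ℕ} (o : Obs d) : Fin d → ℝ := o.1

/-- The outcome `Z₂`. -/
def z2 {d : ℕ} (o : Obs d) : ℝ := o.2.1

/-- The observation indicator `R`, as a number in `{0, 1}`. -/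
def rInd {d : ℕ} (o : Obs d) : ℝ := if o.2.2 then 1 else 0

/-- The σ-algebra generated by `Z₁`. -/
abbrev sigmaZ1 (d : ℕ) : MeasurableSpace (Obs d) := MeasurableSpace.comap z1 inferInstance

/-- The σ-algebra generated by `(Z₁, Z₂)`. -/
abbrev sigmaZ (d : ℕ) : MeasurableSpace (Obs d) :=
  MeasurableSpace.comap (fun o => (z1 o, z2 o)) inferInstance

/-- The ingredients chosen by the statistician. The parameter of interest is `β = (μ, σ) : Vec 2`,
with `β 0 = μ` and `β 1 = σ`; the nuisance parameters are `γ : Vec p` and `ξ : Vec q`. -/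
structure Ingredients (d p q : ℕ) where
  /-- the family `c ↦ ψ_c` -/
  psi : ℝ → ℝ → ℝ
  /-- tuning constant for the location equation -/
  cMu : ℝ
  /-- tuning constant for the scale equation -/
  cSigma : ℝ
  /-- propensity model `π(Z₁; γ)` -/
  prop : (Fin d → ℝ) → Vec p → ℝ
  /-- outcome working model `h(Z₁; β, ξ) = (h₁, h₂)` -/
  h : (Fin d → ℝ) → Vec 2 → Vec q → Vec 2
  /-- estimating function `m_γ(R, Z₁; γ)` -/
  mGamma : Bool → (Fin d → ℝ) → Vec p → Vec p
  /-- estimating function `m_ξ(Z; ξ)`, which is used only for observations with `R = 1` -/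
  mXi : (Fin d → ℝ) → ℝ → Vec q → Vec q
  measurable_psiMu : Measurable (psi cMu)
  measurable_psiSigma : Measurable (psi cSigma)
  measurable_prop : Measurable fun x : (Fin d → ℝ) × Vec p => prop x.1 x.2
  measurable_h : Measurable fun x : (Fin d → ℝ) × Vec 2 × Vec q => h x.1 x.2.1 x.2.2
  measurable_mGamma : Measurable fun x : Bool × (Fin d → ℝ) × Vec p => mGamma x.1 x.2.1 x.2.2
  measurable_mXi : Measurable fun x : (Fin d → ℝ) × ℝ × Vec q => mXi x.1 x.2.1 x.2.2
  prop_pos : ∀ z γ, 0 < prop z γ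

variable {d p q : ℕ}

/-- Missing at random: `Pr(R = 1 ∣ Z₂, Z₁) = π(Z₁)` with `π(Z₁) > 0`. -/
def MissingAtRandom (P : Measure (Obs d)) : Prop :=
  ∃ π₀ : (Fin d → ℝ) → ℝ, Measurable π₀ ∧ (∀ᵐ o ∂P, 0 < π₀ (z1 o)) ∧
    P[rInd | sigmaZ d] =ᵐ[P] fun o => π₀ (z1 o)

/-- `A = E ψ_{c_μ}((Z₂ - μ₀)/σ₀)`. -/
def constA (M : Ingredients d p q) (P : Measure (Obs d)) (β₀ : Vec 2) : ℝ :=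
  ∫ o, M.psi M.cMu ((z2 o - β₀ 0) / β₀ 1) ∂P

/-- `B = E ψ_{c_σ}²((Z₂ - μ₀)/σ₀)`. -/
def constB (M : Ingredients d p q) (P : Measure (Obs d)) (β₀ : Vec 2) : ℝ :=
  ∫ o, (M.psi M.cSigma ((z2 o - β₀ 0) / β₀ 1)) ^ 2 ∂P

/-- The full-data estimating function `m_ψ(Z₂; β)`. -/
def mPsi (M : Ingredients d p q) (P : Measure (Obs d)) (β₀ : Vec 2) (o : Obs d) (β : Vec 2) :
    Vec 2 :=
  !₂[M.psi M.cMu ((z2 o - β 0) / β 1) - constA M P β₀,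
    (M.psi M.cSigma ((z2 o - β 0) / β 1)) ^ 2 - constB M P β₀]

/-- The estimating function `φ_RAIPW(Z, R; β, γ, ξ)`. -/
def phi (M : Ingredients d p q) (P : Measure (Obs d)) (β₀ : Vec 2) (o : Obs d)
    (β : Vec 2) (γ : Vec p) (ξ : Vec q) : Vec 2 :=
  (rInd o / M.prop (z1 o) γ) • mPsi M P β₀ o β
    - ((rInd o - M.prop (z1 o) γ) / M.prop (z1 o) γ) • M.h (z1 o) β ξ

/-- `m_γ(R, Z₁; γ)` at an observation. -/
def obsMGamma (M : Ingredients d p q) (o : Obs d) (γ : Vec p) : Vec p :=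
  M.mGamma o.2.2 (z1 o) γ

/-- `R m_ξ(Z; ξ)` at an observation. -/
def obsMXi (M : Ingredients d p q) (o : Obs d) (ξ : Vec q) : Vec q :=
  rInd o • M.mXi (z1 o) (z2 o) ξ

/-- The propensity model is correctly specified at `γ`: `Pr(R = 1 ∣ Z₁) = π(Z₁; γ)`. -/
def PropensityCorrect (M : Ingredients d p q) (P : Measure (Obs d)) (γ : Vec p) : Prop :=
  P[rInd | sigmaZ1 d] =ᵐ[P] fun o => M.prop (z1 o) γ

/-- The working model is correctly specified at `ξ`: `h(Z₁; β, ξ) = E(m_ψ(Z₂; β) ∣ Z₁)` for every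
`β` in the parameter space. -/
def OutcomeCorrect (M : Ingredients d p q) (P : Measure (Obs d)) (β₀ : Vec 2)
    (B : Set (Vec 2)) (ξ : Vec q) : Prop :=
  ∀ β ∈ B, Integrable (fun o => mPsi M P β₀ o β) P ∧
    P[fun o => mPsi M P β₀ o β | sigmaZ1 d] =ᵐ[P] fun o => M.h (z1 o) β ξ

/-- `E (sup_{s ∈ S} f(O, s)) < ∞` for a nonnegative `f`, expressed through an integrable
majorant so that measurability of the supremum is not an issue. -/
def FiniteExpectedSup {α : Type*} (P : Measure (Obs d)) (S : Set α) (f : Obs d → α → ℝ) : Prop :=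
  ∃ G : Obs d → ℝ, Integrable G P ∧ ∀ᵐ o ∂P, ∀ s ∈ S, f o s ≤ G o

/-- Regularity conditions for consistency (beyond convergence of the nuisance estimators). -/
structure ConsistencyConditions (M : Ingredients d p q) (P : Measure (Obs d)) (β₀ : Vec 2)
    (γs : Vec p) (ξs : Vec q) (B : Set (Vec 2)) : Prop where
  /-- `π` and `h` are continuously differentiable in the nuisance parameters near their limits, and
  the derivatives of `φ` in the nuisance parameters have an integrable supremum over `β ∈ B` and
  over the nuisance parameters near their limits. -/
  smooth_nuisance : ∃ U : Set (Vec p), ∃ V : Set (Vec q),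
    IsOpen U ∧ γs ∈ U ∧ IsOpen V ∧ ξs ∈ V ∧
    (∀ᵐ o ∂P, ContDiffOn ℝ 1 (M.prop (z1 o)) U) ∧
    (∀ᵐ o ∂P, ∀ β ∈ B, ContDiffOn ℝ 1 (M.h (z1 o) β) V) ∧
    FiniteExpectedSup P (B ×ˢ U ×ˢ V)
      (fun o x => ‖fderiv ℝ (fun γ => phi M P β₀ o x.1 γ x.2.2) x.2.1‖) ∧
    FiniteExpectedSup P (B ×ˢ U ×ˢ V)
      (fun o x => ‖fderiv ℝ (fun ξ => phi M P β₀ o x.1 x.2.1 ξ) x.2.2‖)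
  compact : IsCompact B
  mem : β₀ ∈ B
  identification : ∀ β ∈ B, ∫ o, mPsi M P β₀ o β ∂P = 0 → β = β₀
  overlap : ∃ ε : ℝ, 0 < ε ∧ ∀ᵐ o ∂P, ε < M.prop (z1 o) γs ∧ M.prop (z1 o) γs ≤ 1
  continuous_psi : ∀ β ∈ B, ∀ᵐ o ∂P,
    ContinuousWithinAt (fun b : Vec 2 => M.psi M.cMu ((z2 o - b 0) / b 1)) B β ∧
    ContinuousWithinAt (fun b : Vec 2 => M.psi M.cSigma ((z2 o - b 0) / b 1)) B β
  continuous_h : ∀ β ∈ B, ∀ᵐ o ∂P, ContinuousWithinAt (fun b => M.h (z1 o) b ξs) B β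
  moment_psiMu : FiniteExpectedSup P B
    (fun o β => |M.psi M.cMu ((z2 o - β 0) / β 1)| ^ 2)
  moment_psiSigma : FiniteExpectedSup P B
    (fun o β => |(M.psi M.cSigma ((z2 o - β 0) / β 1)) ^ 2| ^ 2)
  moment_h : ∀ j : Fin 2, FiniteExpectedSup P B (fun o β => (M.h (z1 o) β ξs j) ^ 2)

/-- The space of `θ = (μ, σ, γ', ξ')'`. -/
abbrev Theta (p q : ℕ) : Type := EuclideanSpace ℝ (Fin 2 ⊕ Fin p ⊕ Fin q)

/-- Stacking three vectors. -/
def stack (β : Vec 2) (γ : Vec p) (ξ : Vec q) : Theta p q :=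
  WithLp.toLp 2 (Sum.elim β (Sum.elim γ ξ))

/-- The `(μ, σ)` block of `θ`. -/
def betaPart (θ : Theta p q) : Vec 2 := WithLp.toLp 2 fun i => θ (Sum.inl i)

/-- The `γ` block of `θ`. -/
def gammaPart (θ : Theta p q) : Vec p := WithLp.toLp 2 fun i => θ (Sum.inr (Sum.inl i))

/-- The `ξ` block of `θ`. -/
def xiPart (θ : Theta p q) : Vec q := WithLp.toLp 2 fun i => θ (Sum.inr (Sum.inr i))

/-- The stacked estimating function `φ̃(θ)`. -/
def phiTilde (M : Ingredients d p q) (P : Measure (Obs d)) (β₀ : Vec 2) (o : Obs d)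
    (θ : Theta p q) : Theta p q :=
  stack (phi M P β₀ o (betaPart θ) (gammaPart θ) (xiPart θ))
    (obsMGamma M o (gammaPart θ)) (obsMXi M o (xiPart θ))

/-- The Jacobian matrix `∂f/∂x'`. -/
def jacobian {ι κ : Type*} [Fintype ι] [DecidableEq ι] [Fintype κ]
    (f : EuclideanSpace ℝ ι → EuclideanSpace ℝ κ) (x : EuclideanSpace ℝ ι) : Matrix κ ι ℝ :=
  Matrix.of fun k i => fderiv ℝ f x (EuclideanSpace.single i 1) k

/-- The expected Jacobian matrix `E[∂f(O; x)/∂x']`. -/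
def expJacobian {ι κ : Type*} [Fintype ι] [DecidableEq ι] [Fintype κ] (P : Measure (Obs d))
    (f : Obs d → EuclideanSpace ℝ ι → EuclideanSpace ℝ κ) (x : EuclideanSpace ℝ ι) :
    Matrix κ ι ℝ :=
  Matrix.of fun k i => ∫ o, jacobian (f o) x k i ∂P

/-- Regularity conditions for asymptotic normality. The parameter space of `θ` is
`B × ℝᵖ × ℝ^q`. -/
structure NormalityConditions (M : Ingredients d p q) (P : Measure (Obs d)) (β₀ : Vec 2)
    (γs : Vec p) (ξs : Vec q) (B : Set (Vec 2)) : Prop where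
  interior_mem : stack β₀ γs ξs ∈ interior {θ : Theta p q | betaPart θ ∈ B}
  mean_zero : ∫ o, phiTilde M P β₀ o (stack β₀ γs ξs) ∂P = 0
  second_moment : MemLp (fun o => phiTilde M P β₀ o (stack β₀ γs ξs)) 2 P
  smooth : ∃ N : Set (Theta p q), IsOpen N ∧ stack β₀ γs ξs ∈ N ∧
    (∀ᵐ o ∂P, ContDiffOn ℝ 1 (phiTilde M P β₀ o) N) ∧
    FiniteExpectedSup P N (fun o θ => ‖fderiv ℝ (phiTilde M P β₀ o) θ‖)
  nonsingular : IsUnit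
    ((expJacobian P (phiTilde M P β₀) (stack β₀ γs ξs)).transpose *
      expJacobian P (phiTilde M P β₀) (stack β₀ γs ξs))
  /-- The expectation `E[∂m_ψ(Z₂; β₀)/∂β']` exists. -/
  differentiable_mPsi : ∀ᵐ o ∂P, DifferentiableAt ℝ (mPsi M P β₀ o) β₀
  integrable_mPsi : ∀ k i, Integrable (fun o => jacobian (mPsi M P β₀ o) β₀ k i) P

/-- The influence function of the robust augmented IPW estimator. -/
def influence (M : Ingredients d p q) (P : Measure (Obs d)) (β₀ : Vec 2)
    (γs : Vec p) (ξs : Vec q) (o : Obs d) : Vec 2 :=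
  WithLp.toLp 2 <|
    -((expJacobian P (mPsi M P β₀) β₀)⁻¹.mulVec
      ((phi M P β₀ o β₀ γs ξs).ofLp
        - (expJacobian P (fun o γ => phi M P β₀ o β₀ γ ξs) γs).mulVec
            ((expJacobian P (obsMGamma M) γs)⁻¹.mulVec (obsMGamma M o γs).ofLp)
        - (expJacobian P (fun o ξ => phi M P β₀ o β₀ γs ξ) ξs).mulVec
            ((expJacobian P (obsMXi M) ξs)⁻¹.mulVec (obsMXi M o ξs).ofLp)))

/-- The asymptotic variance `E[IF IF']`. -/
def asymptoticVariance (M : Ingredients d p q) (P : Measure (Obs d)) (β₀ : Vec 2)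
    (γs : Vec p) (ξs : Vec q) : Matrix (Fin 2) (Fin 2) ℝ :=
  Matrix.of fun a b => ∫ o, influence M P β₀ γs ξs o a * influence M P β₀ γs ξs o b ∂P

/-- The criterion `Q̂(β; γ, ξ) = n⁻² (∑ φᵢ)'(∑ φᵢ)` of the sample `o₀, …, o_{n-1}`. -/
def Qhat (M : Ingredients d p q) (P : Measure (Obs d)) (β₀ : Vec 2) (n : ℕ) (o : ℕ → Obs d)
    (β : Vec 2) (γ : Vec p) (ξ : Vec q) : ℝ :=
  ((n : ℝ) ^ 2)⁻¹ * ‖∑ i ∈ Finset.range n, phi M P β₀ (o i) β γ ξ‖ ^ 2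

/-- The event `p n` has probability tending to one. -/
def EventuallyLikely {Ω : Type*} [MeasurableSpace Ω] (Pr : Measure Ω) (p : ℕ → Ω → Prop) : Prop :=
  Tendsto (fun n => Pr {ω | ¬ p n ω}) atTop (𝓝 0)

end RobustAIPW

end

/-!
The error `φ - m_ψ = ((R - π) / π) (m_ψ - h)` has conditional mean zero given `Z₁` as soon as one of
the two models is correct, so that `E φ(β, γ*, ξ*) = E m_ψ(β)` on `B`.

Consistency: the empirical mean of `φ` converges uniformly on the compact set `B` at `(γ*, ξ*)`,
and replacing `(γ*, ξ*)` by the estimators costs at most an integrable factor times their error.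
Hence the minimizer drives `‖E m_ψ‖` to zero, and `β₀` is a well-separated zero. Suprema over
uncountable sets of parameters are measurable because analytic sets are universally measurable.

Asymptotic normality: near `θ₀` the empirical mean of `φ̃` has, with probability tending to one, the
increments of the invertible linear map `E ∇φ̃(θ₀)` up to a small relative error. A Newton step from
the estimator therefore halves the residual. Since the nuisance equations are solved exactly, this
step only moves `β`, so it would improve on the minimizer unless the residual is already zero. Thus
the stacked equations are solved and can be linearized. Their Jacobian is block triangular, with
`E ∂φ/∂β' = E ∂m_ψ/∂β'` by double robustness of the difference quotients, and the `β`-component of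
its inverse is the influence function.
-/

namespace RobustAIPW

/-! ### Analytic sets are universally measurable -/

section AnalyticSets

open Set

variable {α β : Type*} [MeasurableSpace α] [MeasurableSpace β]

theorem exists_lt_measure_image_inter {μ : Measure α} {f : (ℕ → ℕ) → α} {c : ENNReal}
    {S : Set (ℕ → ℕ)} (hc : c < μ (f '' S)) (n : ℕ) :
    ∃ m : ℕ, c < μ (f '' (S ∩ {x | x n ≤ m})) := by
  have hS : f '' S = ⋃ m : ℕ, f '' (S ∩ {x | x n ≤ m}) := by
    rw [← image_iUnion, ← inter_iUnion, inter_eq_left.2]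
    exact fun x _ => mem_iUnion.2 ⟨x n, le_refl (x n)⟩
  have hmono : Monotone fun m : ℕ => f '' (S ∩ {x | x n ≤ m}) := fun a b hab =>
    image_mono (inter_subset_inter_right _ fun x (hx : x n ≤ a) => hx.trans hab)
  rwa [hS, hmono.measure_iUnion, lt_iSup_iff] at hc

theorem exists_forall_lt_measure_image {μ : Measure α} {f : (ℕ → ℕ) → α} {c : ENNReal}
    (hc : c < μ (range f)) :
    ∃ k : ℕ → ℕ, ∀ n, c < μ (f '' {x | ∀ i < n, x i ≤ k i}) := by
  choose! m hm using fun (S : Set (ℕ → ℕ)) (hS : c < μ (f '' S)) =>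
    exists_lt_measure_image_inter hS
  let S : ℕ → Set (ℕ → ℕ) := fun n => n.rec univ fun n T => T ∩ {x | x n ≤ m T n}
  have hcS : ∀ n, c < μ (f '' S n) := by
    intro n
    induction n with
    | zero => simpa [S] using hc
    | succ n ih => exact hm _ ih n
  have hS : ∀ n, S n ⊆ {x | ∀ i < n, x i ≤ m (S i) i} := by
    intro n
    induction n with
    | zero => simp
    | succ n ih =>
      intro x hx i hi
      rcases Nat.lt_succ_iff_lt_or_eq.1 hi with h | rfl
      exacts [ih hx.1 i h, hx.2]
  exact ⟨fun n => m (S n) n, fun n => (hcS n).trans_le (measure_mono (image_mono (hS n)))⟩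

theorem exists_forall_lt_le_subset_of_isOpen {k : ℕ → ℕ} {V : Set (ℕ → ℕ)} (hV : IsOpen V)
    (hk : Iic k ⊆ V) : ∃ n, {x : ℕ → ℕ | ∀ i < n, x i ≤ k i} ⊆ V := by
  by_contra! hcon
  choose x hx hxV using fun n => not_subset.1 (hcon n)
  have hcpt : IsCompact (Iic k) := Icc_bot (a := k) ▸ isCompact_Icc
  obtain ⟨a, hak, φ, hφ, hlim⟩ := hcpt.tendsto_subseq (x := fun n => x n ⊓ k)
    fun n => mem_Iic.2 inf_le_right
  have hxlim : Tendsto (x ∘ φ) atTop (𝓝 a) := by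
    refine tendsto_pi_nhds.2 fun i => (tendsto_pi_nhds.1 hlim i).congr' ?_
    filter_upwards [eventually_gt_atTop i] with n hn
    exact inf_eq_left.2 (hx (φ n) i (hn.trans_le (hφ.id_le n)))
  exact hV.isClosed_compl.mem_of_tendsto hxlim (Eventually.of_forall fun n => hxV (φ n)) (hk hak)

theorem exists_isCompact_subset_range_le_measure [TopologicalSpace α] (μ : Measure α)
    [μ.OuterRegular] {f : (ℕ → ℕ) → α} (hf : Continuous f) {c : ENNReal} (hc : c < μ (range f)) :
    ∃ K ⊆ range f, IsCompact K ∧ c ≤ μ K := by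
  obtain ⟨k, hk⟩ := exists_forall_lt_measure_image hc
  have hcpt : IsCompact (Iic k) := Icc_bot (a := k) ▸ isCompact_Icc
  refine ⟨f '' Iic k, image_subset_range f _, hcpt.image hf, ?_⟩
  rw [Set.measure_eq_iInf_isOpen]
  refine le_iInf₂ fun U hkU => le_iInf fun hU => ?_
  obtain ⟨n, hn⟩ := exists_forall_lt_le_subset_of_isOpen (hU.preimage hf) (image_subset_iff.1 hkU)
  exact (hk n).le.trans (measure_mono (image_subset_iff.2 hn))

theorem nullMeasurableSet_of_analyticSet [TopologicalSpace α] [T2Space α] [BorelSpace α]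
    (μ : Measure α) [IsFiniteMeasure μ] [μ.OuterRegular] {s : Set α} (hs : AnalyticSet s) :
    NullMeasurableSet s μ := by
  rw [AnalyticSet] at hs
  rcases hs with rfl | ⟨f, hf, rfl⟩
  · exact nullMeasurableSet_empty
  by_cases h0 : μ (range f) = 0
  · exact NullMeasurableSet.of_null h0
  obtain ⟨c, -, hc, hclim⟩ := exists_seq_strictMono_tendsto' (pos_iff_ne_zero.2 h0)
  choose K hKs hK hcK using fun n => exists_isCompact_subset_range_le_measure μ hf (hc n).2
  have hUm : MeasurableSet (⋃ n, K n) := MeasurableSet.iUnion fun n => (hK n).measurableSet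
  have hle : μ (range f) ≤ μ (⋃ n, K n) :=
    le_of_tendsto' hclim fun n => (hcK n).trans (measure_mono (subset_iUnion K n))
  exact ⟨⋃ n, K n, hUm, (ae_eq_of_subset_of_measure_ge (iUnion_subset hKs) hle
    hUm.nullMeasurableSet (measure_ne_top _ _)).symm⟩

variable [StandardBorelSpace α] [StandardBorelSpace β]

theorem nullMeasurableSet_image_fst (μ : Measure α) [IsFiniteMeasure μ] {s : Set (α × β)}
    (hs : MeasurableSet s) : NullMeasurableSet (Prod.fst '' s) μ := by
  let _ := upgradeStandardBorel α
  let _ := upgradeStandardBorel β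
  exact nullMeasurableSet_of_analyticSet μ (hs.analyticSet.image_of_continuous continuous_fst)

theorem aemeasurable_biSup_of_measurable_prod (μ : Measure α) [IsFiniteMeasure μ]
    {g : α × β → ENNReal} (hg : Measurable g) {S : Set β} (hS : MeasurableSet S) :
    AEMeasurable (fun a => ⨆ b ∈ S, g (a, b)) μ := by
  refine NullMeasurable.aemeasurable ?_
  refine measurable_of_Ioi (α := ENNReal) (δ := NullMeasurableSpace α μ) fun c => ?_
  have himage : (fun a => ⨆ b ∈ S, g (a, b)) ⁻¹' Ioi c
      = Prod.fst '' ({x : α × β | c < g x} ∩ Prod.snd ⁻¹' S) := by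
    ext a
    simp only [mem_preimage, mem_Ioi, lt_iSup_iff, mem_image, mem_inter_iff, mem_ofPred_eq,
      Prod.exists, exists_and_right, exists_eq_right, exists_prop]
    exact exists_congr fun b => and_comm
  exact himage ▸ nullMeasurableSet_image_fst μ
    ((measurableSet_lt measurable_const hg).inter (measurable_snd hS))

theorem tendsto_lintegral_biSup_zero (μ : Measure α) [IsFiniteMeasure μ] {g : α × β → ENNReal}
    (hg : Measurable g) {S : ℕ → Set β} (hS : ∀ k, MeasurableSet (S k)) (hanti : Antitone S)
    {G : α → ENNReal} (hG : ∫⁻ a, G a ∂μ ≠ ⊤) (hgG : ∀ᵐ a ∂μ, ∀ b ∈ S 0, g (a, b) ≤ G a)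
    (hlim : ∀ᵐ a ∂μ, ∀ ε > 0, ∃ k, ∀ b ∈ S k, g (a, b) ≤ ε) :
    Tendsto (fun k => ∫⁻ a, ⨆ b ∈ S k, g (a, b) ∂μ) atTop (𝓝 0) := by
  rw [← lintegral_zero (μ := μ)]
  refine tendsto_lintegral_of_dominated_convergence' G
    (fun k => aemeasurable_biSup_of_measurable_prod μ hg (hS k)) (fun k => ?_) hG ?_
  · filter_upwards [hgG] with a ha
    exact iSup₂_le fun b hb => ha b (hanti (Nat.zero_le k) hb)
  · filter_upwards [hlim] with a ha
    refine ENNReal.tendsto_nhds_zero.2 fun ε hε => ?_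
    obtain ⟨k, hk⟩ := ha ε hε
    filter_upwards [eventually_ge_atTop k] with j hj
    exact iSup₂_le fun b hb => hk b (hanti hj hb)

theorem exists_integrable_majorant_integral_lt (μ : Measure α) [IsFiniteMeasure μ] {g : α → β → ℝ}
    (hg : Measurable fun x : α × β => g x.1 x.2) {S : ℕ → Set β} (hS : ∀ k, MeasurableSet (S k))
    (hanti : Antitone S) {G : α → ℝ} (hG : Integrable G μ)
    (hgG : ∀ᵐ a ∂μ, ∀ b ∈ S 0, g a b ≤ G a)
    (hlim : ∀ᵐ a ∂μ, ∀ ε > 0, ∃ k, ∀ b ∈ S k, g a b ≤ ε) {ε : ℝ} (hε : 0 < ε) :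
    ∃ k, ∃ ρ : α → ℝ, Integrable ρ μ ∧ ∫ a, ρ a ∂μ < ε ∧ ∀ᵐ a ∂μ, ∀ b ∈ S k, g a b ≤ ρ a := by
  have hlim' : ∀ᵐ a ∂μ, ∀ η > 0, ∃ k, ∀ b ∈ S k, ENNReal.ofReal (g a b) ≤ η := by
    filter_upwards [hlim] with a ha η hη
    rcases eq_or_ne η ⊤ with rfl | htop
    · exact ⟨0, fun _ _ => le_top⟩
    obtain ⟨k, hk⟩ := ha η.toReal (ENNReal.toReal_pos hη.ne' htop)
    exact ⟨k, fun b hb => ENNReal.ofReal_le_of_le_toReal (hk b hb)⟩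
  obtain ⟨k, hk⟩ := ((tendsto_lintegral_biSup_zero μ hg.ennreal_ofReal hS hanti
    hG.lintegral_lt_top.ne (hgG.mono fun a ha b hb => ENNReal.ofReal_le_ofReal (ha b hb))
    hlim').eventually_lt_const (ENNReal.ofReal_pos.2 hε)).exists
  set s : α → ENNReal := fun a => ⨆ b ∈ S k, ENNReal.ofReal (g a b)
  have hs : AEMeasurable s μ := aemeasurable_biSup_of_measurable_prod μ hg.ennreal_ofReal (hS k)
  have htop : ∫⁻ a, s a ∂μ ≠ ⊤ := (hk.trans ENNReal.ofReal_lt_top).ne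
  have hfin : ∀ᵐ a ∂μ, s a < ⊤ := ae_lt_top' hs htop
  refine ⟨k, fun a => (s a).toReal, integrable_toReal_of_lintegral_ne_top hs htop, ?_, ?_⟩
  · rw [integral_toReal hs hfin]
    exact (ENNReal.lt_ofReal_iff_toReal_lt htop).1 hk
  · filter_upwards [hfin] with a ha b hb
    rw [← ENNReal.ofReal_le_iff_le_toReal ha.ne]
    exact le_iSup₂ (f := fun b (_ : b ∈ S k) => ENNReal.ofReal (g a b)) b hb

end AnalyticSets

/-! ### Events of probability tending to one -/

section EventuallyLikely

variable {Ω : Type*} [MeasurableSpace Ω] {Pr : Measure Ω} {p r : ℕ → Ω → Prop}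

theorem EventuallyLikely.mono (hp : EventuallyLikely Pr p)
    (h : ∀ᶠ n in atTop, ∀ᵐ ω ∂Pr, p n ω → r n ω) : EventuallyLikely Pr r := by
  refine tendsto_of_tendsto_of_tendsto_of_le_of_le' tendsto_const_nhds hp
    (Eventually.of_forall fun _ => zero_le) ?_
  filter_upwards [h] with n hn
  refine measure_mono_ae ?_
  filter_upwards [hn] with ω hω using fun hr hp => hr (hω hp)

theorem EventuallyLikely.mono' (hp : EventuallyLikely Pr p) (h : ∀ n ω, p n ω → r n ω) :
    EventuallyLikely Pr r :=
  hp.mono (Eventually.of_forall fun n => ae_of_all _ (h n))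

theorem EventuallyLikely.and (hp : EventuallyLikely Pr p) (hr : EventuallyLikely Pr r) :
    EventuallyLikely Pr fun n ω => p n ω ∧ r n ω := by
  have hpr := hp.add hr
  rw [add_zero] at hpr
  refine tendsto_of_tendsto_of_tendsto_of_le_of_le tendsto_const_nhds hpr
    (fun _ => zero_le) fun n => ?_
  refine le_trans (measure_mono fun ω hω => ?_) (measure_union_le _ _)
  simpa [not_and_or, or_iff_not_imp_left] using hω

theorem eventuallyLikely_of_ae (h : ∀ᶠ n in atTop, ∀ᵐ ω ∂Pr, p n ω) : EventuallyLikely Pr p := by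
  refine tendsto_const_nhds.congr' ?_
  filter_upwards [h] with n hn using (ae_iff.1 hn).symm

theorem EventuallyLikely.finset_forall {ι : Type*} (t : Finset ι) {p : ι → ℕ → Ω → Prop}
    (hp : ∀ j ∈ t, EventuallyLikely Pr (p j)) :
    EventuallyLikely Pr fun n ω => ∀ j ∈ t, p j n ω := by
  classical
  induction t using Finset.induction_on with
  | empty => exact eventuallyLikely_of_ae (by simp)
  | insert a t _ ih =>
    simp only [Finset.mem_insert, forall_eq_or_imp] at hp ⊢
    exact hp.1.and (ih hp.2)

theorem tendstoInMeasure_const_iff_eventuallyLikely {E : Type*} [SeminormedAddCommGroup E]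
    {X : ℕ → Ω → E} {c : E} :
    TendstoInMeasure Pr X atTop (fun _ => c) ↔
      ∀ ε > 0, EventuallyLikely Pr fun n ω => ‖X n ω - c‖ < ε := by
  simp only [tendstoInMeasure_iff_norm, EventuallyLikely, not_lt]

end EventuallyLikely

/-! ### Empirical means -/

section EmpiricalMean

variable {α E F : Type*} [NormedAddCommGroup E] [NormedSpace ℝ E] [NormedAddCommGroup F]
  [NormedSpace ℝ F]

/-- The average `n⁻¹ ∑_{i < n} f (x i)` over the first `n` points of a sample; it is `0` when
`n = 0`. -/
noncomputable def empiricalMean (x : ℕ → α) (n : ℕ) (f : α → E) : E :=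
  (n : ℝ)⁻¹ • ∑ i ∈ Finset.range n, f (x i)

theorem empiricalMean_sub (x : ℕ → α) (n : ℕ) (f g : α → E) :
    empiricalMean x n (fun a => f a - g a) = empiricalMean x n f - empiricalMean x n g := by
  simp only [empiricalMean, Finset.sum_sub_distrib, smul_sub]

theorem empiricalMean_clm_comp (x : ℕ → α) (n : ℕ) (L : E →L[ℝ] F) (f : α → E) :
    empiricalMean x n (fun a => L (f a)) = L (empiricalMean x n f) := by
  simp only [empiricalMean, map_smul, map_sum]

theorem empiricalMean_mul_const (x : ℕ → α) (n : ℕ) (f : α → ℝ) (c : ℝ) :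
    empiricalMean x n (fun a => f a * c) = empiricalMean x n f * c := by
  simp only [empiricalMean, ← Finset.sum_mul, smul_eq_mul, mul_assoc]

theorem norm_empiricalMean_le {x : ℕ → α} {f : α → E} {g : α → ℝ} (h : ∀ i, ‖f (x i)‖ ≤ g (x i))
    (n : ℕ) : ‖empiricalMean x n f‖ ≤ empiricalMean x n g := by
  rw [empiricalMean, empiricalMean, norm_smul, norm_inv, Real.norm_natCast, smul_eq_mul]
  gcongr
  exact norm_sum_le_of_le _ fun i _ => h i

end EmpiricalMean

section Sample

variable {Ω α E : Type*} [MeasurableSpace Ω] [MeasurableSpace α] {Pr : Measure Ω}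
  {P : Measure α} {O : ℕ → Ω → α}

theorem ae_forall_sample (hlaw : ∀ i, HasLaw (O i) P Pr) {p : α → Prop} (hp : ∀ᵐ o ∂P, p o) :
    ∀ᵐ ω ∂Pr, ∀ i, p (O i ω) := by
  rw [ae_all_iff]
  intro i
  rw [← (hlaw i).map_eq] at hp
  exact ae_of_ae_map (hlaw i).aemeasurable hp

theorem identDistrib_comp_sample (hlaw : ∀ i, HasLaw (O i) P Pr) [MeasurableSpace E]
    {f : α → E} (hf : AEMeasurable f P) (i j : ℕ) :
    IdentDistrib (fun ω => f (O i ω)) (fun ω => f (O j ω)) Pr Pr :=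
  ((hlaw i).identDistrib (hlaw j)).comp_of_aemeasurable (u := f) (by rwa [(hlaw i).map_eq])

theorem eventuallyLikely_empiricalMean [IsFiniteMeasure Pr] (hlaw : ∀ i, HasLaw (O i) P Pr)
    (hindep : Pairwise fun i j => IndepFun (O i) (O j) Pr)
    [NormedAddCommGroup E] [NormedSpace ℝ E] [CompleteSpace E] {f : α → E}
    (hf : Integrable f P) {ε : ℝ} (hε : 0 < ε) :
    EventuallyLikely Pr fun n ω => ‖empiricalMean (O · ω) n f - ∫ o, f o ∂P‖ < ε := by
  borelize E
  have hf' : ∀ i, Integrable f (Pr.map (O i)) := fun i => by rwa [(hlaw i).map_eq]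
  have hInt : ∀ i, Integrable (fun ω => f (O i ω)) Pr := fun i =>
    (hf' i).comp_aemeasurable (hlaw i).aemeasurable
  have hlln := strong_law_ae (fun i ω => f (O i ω)) (hInt 0)
    (fun i j hij => (hindep hij).comp₀ (hlaw i).aemeasurable (hlaw j).aemeasurable
      (hf' i).1.aemeasurable (hf' j).1.aemeasurable)
    (fun i => identDistrib_comp_sample hlaw hf.1.aemeasurable i 0)
  rw [← integral_map (hlaw 0).aemeasurable (hf' 0).1, (hlaw 0).map_eq] at hlln
  refine tendstoInMeasure_const_iff_eventuallyLikely.1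
    (tendstoInMeasure_of_tendsto_ae (fun n => ?_) hlln) ε hε
  exact (Finset.aestronglyMeasurable_fun_sum _ fun i _ => (hInt i).1).const_smul _

end Sample

/-! ### The multivariate central limit theorem -/

section CramerWold

variable {E : Type*} [NormedAddCommGroup E] [InnerProductSpace ℝ E] [MeasurableSpace E]
  [BorelSpace E]

theorem charFun_map_inner {Ω : Type*} [MeasurableSpace Ω] {μ : Measure Ω} {X : Ω → E}
    (hX : AEMeasurable X μ) (t : E) :
    charFun (μ.map X) t = charFun (μ.map fun ω => inner ℝ t (X ω)) 1 := by
  have ht : AEMeasurable (fun ω => inner ℝ t (X ω)) μ :=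
    (innerSL ℝ t).continuous.measurable.comp_aemeasurable hX
  rw [charFun_apply, charFun_apply, integral_map hX (by fun_prop), integral_map ht (by fun_prop)]
  simp [real_inner_comm]

theorem tendstoInDistribution_of_forall_inner [FiniteDimensional ℝ E] {Ω Ω' : Type*}
    [MeasurableSpace Ω] [MeasurableSpace Ω'] {Pr : Measure Ω} [IsProbabilityMeasure Pr]
    {P : Measure Ω'} [IsProbabilityMeasure P] {X : ℕ → Ω → E} {Z : Ω' → E}
    (hX : ∀ n, AEMeasurable (X n) Pr) (hZ : AEMeasurable Z P)
    (h : ∀ t, TendstoInDistribution (fun n ω => inner ℝ t (X n ω)) atTop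
      (fun ω => inner ℝ t (Z ω)) (fun _ => Pr) P) :
    TendstoInDistribution X atTop Z (fun _ => Pr) P := by
  refine ⟨hX, hZ, ProbabilityMeasure.tendsto_iff_tendsto_charFun.2 fun t => ?_⟩
  have ht := ProbabilityMeasure.tendsto_iff_tendsto_charFun.1 (h t).tendsto 1
  simpa only [ProbabilityMeasure.coe_mk, charFun_map_inner (hX _) t, charFun_map_inner hZ t]
    using ht

end CramerWold

section CentralLimit

variable {Ω α ι : Type*} [MeasurableSpace Ω] [MeasurableSpace α] [Fintype ι] {Pr : Measure Ω}
  {P : Measure α} {O : ℕ → Ω → α} {f : α → EuclideanSpace ℝ ι}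

theorem dotProduct_secondMoment_mulVec (hf : MemLp f 2 P) (s t : EuclideanSpace ℝ ι) :
    s.ofLp ⬝ᵥ (Matrix.of fun a b => ∫ o, f o a * f o b ∂P).mulVec t.ofLp
      = ∫ o, inner ℝ s (f o) * inner ℝ t (f o) ∂P := by
  have hcoord : ∀ a, MemLp (fun o => f o a) 2 P := fun a =>
    hf.continuousLinearMap_comp (EuclideanSpace.proj a : EuclideanSpace ℝ ι →L[ℝ] ℝ)
  have hInt : ∀ a b, Integrable (fun o => s a * t b * (f o a * f o b)) P := fun a b =>
    ((hcoord a).integrable_mul (hcoord b)).const_mul _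
  have hexpand : ∀ o, inner ℝ s (f o) * inner ℝ t (f o)
      = ∑ a, ∑ b, s a * t b * (f o a * f o b) := by
    intro o
    simp only [PiLp.inner_apply, RCLike.inner_apply, conj_trivial, Finset.sum_mul_sum]
    exact Finset.sum_congr rfl fun a _ => Finset.sum_congr rfl fun b _ => by ring
  simp only [hexpand, integral_finsetSum _ fun a _ => integrable_finsetSum _ fun b _ => hInt a b,
    integral_finsetSum _ fun b _ => hInt _ b, integral_const_mul, dotProduct, Matrix.mulVec,
    Matrix.of_apply, Finset.mul_sum]
  exact Finset.sum_congr rfl fun a _ => Finset.sum_congr rfl fun b _ => by ring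

theorem posSemidef_secondMoment (hf : MemLp f 2 P) :
    (Matrix.of fun a b => ∫ o, f o a * f o b ∂P).PosSemidef := by
  refine Matrix.PosSemidef.of_dotProduct_mulVec_nonneg ?_ fun x => ?_
  · ext a b
    simp [mul_comm]
  · rw [star_trivial, ← WithLp.ofLp_toLp 2 x, dotProduct_secondMoment_mulVec hf]
    exact integral_nonneg fun o => mul_self_nonneg _

theorem hasLaw_inner_multivariateGaussian [DecidableEq ι] {S : Matrix ι ι ℝ}
    (hS : S.PosSemidef) (t : EuclideanSpace ℝ ι) :
    HasLaw (fun x => inner ℝ t x) (gaussianReal 0 (t.ofLp ⬝ᵥ S.mulVec t.ofLp).toNNReal)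
      (multivariateGaussian 0 S) where
  aemeasurable := by fun_prop
  map_eq := by
    rw [← covarianceBilin_multivariateGaussian (μ := 0) hS,
      covarianceBilin_self IsGaussian.memLp_two_id]
    have h := IsGaussian.map_eq_gaussianReal (μ := multivariateGaussian 0 S) (innerSL ℝ t)
    rwa [ContinuousLinearMap.integral_comp_id_comm IsGaussian.integrable_id,
      integral_id_multivariateGaussian, map_zero] at h

theorem tendstoInDistribution_sqrt_mul_empiricalMean [IsProbabilityMeasure Pr]
    (hlaw : ∀ i, HasLaw (O i) P Pr) (hindep : iIndepFun O Pr)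
    {g : α → ℝ} (hg : MemLp g 2 P) (hg0 : ∫ o, g o ∂P = 0) {Ω' : Type*} [MeasurableSpace Ω']
    {P' : Measure Ω'} [IsProbabilityMeasure P'] {Y : Ω' → ℝ}
    (hY : HasLaw Y (gaussianReal 0 (∫ o, g o * g o ∂P).toNNReal) P') :
    TendstoInDistribution (fun (n : ℕ) ω => √n * empiricalMean (O · ω) n g) atTop Y
      (fun _ => Pr) P' := by
  have hgO : ∀ i, AEMeasurable g (Pr.map (O i)) := fun i => by
    rw [(hlaw i).map_eq]
    exact hg.1.aemeasurable
  have hmean : ∫ ω, g (O 0 ω) ∂Pr = 0 := ((hlaw 0).integral_comp hg.1).trans hg0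
  have hvar : Var[fun ω => g (O 0 ω); Pr] = ∫ o, g o * g o ∂P := by
    have hgO₀ : AEMeasurable (fun ω => g (O 0 ω)) Pr :=
      (hgO 0).comp_aemeasurable (hlaw 0).aemeasurable
    rw [variance_of_integral_eq_zero hgO₀ hmean]
    simp only [sq]
    exact (hlaw 0).integral_comp (f := fun o => g o * g o) (hg.1.mul hg.1)
  have hclt := tendstoInDistribution_inv_sqrt_mul_sum_sub (X := fun i ω => g (O i ω)) (Y := Y)
    (P' := P') (by rwa [hvar])
    (MemLp.comp_of_map (by rwa [(hlaw 0).map_eq]) (hlaw 0).aemeasurable)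
    (hindep.comp₀ (fun _ => g) (fun i => (hlaw i).aemeasurable) hgO)
    fun i => identDistrib_comp_sample hlaw hg.1.aemeasurable i 0
  simp only [hmean, mul_zero, sub_zero] at hclt
  convert! hclt using 3 with n ω
  have hsqrt : √(n : ℝ) * (n : ℝ)⁻¹ = (√n)⁻¹ := by
    rw [← div_eq_mul_inv, Real.sqrt_div_self', one_div]
  rw [empiricalMean, smul_eq_mul, ← mul_assoc, hsqrt]

theorem aemeasurable_empiricalMean (hlaw : ∀ i, HasLaw (O i) P Pr) {E : Type*}
    [NormedAddCommGroup E] [NormedSpace ℝ E] [MeasurableSpace E] [BorelSpace E]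
    [SecondCountableTopology E] {f : α → E} (hf : AEMeasurable f P) (n : ℕ) :
    AEMeasurable (fun ω => empiricalMean (O · ω) n f) Pr :=
  (Finset.aemeasurable_fun_sum _ fun i _ => AEMeasurable.comp_aemeasurable (g := f)
    (by rwa [(hlaw i).map_eq]) (hlaw i).aemeasurable).const_smul _

theorem tendstoInDistribution_sqrt_smul_empiricalMean [DecidableEq ι] [IsProbabilityMeasure Pr]
    [IsFiniteMeasure P] (hlaw : ∀ i, HasLaw (O i) P Pr) (hindep : iIndepFun O Pr)
    (hf : MemLp f 2 P) (hf0 : ∫ o, f o ∂P = 0) :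
    TendstoInDistribution (fun (n : ℕ) ω => √n • empiricalMean (O · ω) n f) atTop id
      (fun _ => Pr) (multivariateGaussian 0 (Matrix.of fun a b => ∫ o, f o a * f o b ∂P)) := by
  refine tendstoInDistribution_of_forall_inner
    (fun n => (aemeasurable_empiricalMean hlaw hf.1.aemeasurable n).fun_const_smul _)
    aemeasurable_id fun t => ?_
  have hmean : ∫ o, innerSL ℝ t (f o) ∂P = 0 := by
    rw [(innerSL ℝ t).integral_comp_comm (hf.integrable one_le_two), hf0, map_zero]
  have hlimit := hasLaw_inner_multivariateGaussian (posSemidef_secondMoment hf) t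
  rw [dotProduct_secondMoment_mulVec hf] at hlimit
  convert! tendstoInDistribution_sqrt_mul_empiricalMean hlaw hindep
    (hf.continuousLinearMap_comp (innerSL ℝ t)) hmean hlimit using 3 with n ω
  rw [empiricalMean_clm_comp, innerSL_apply_apply, real_inner_smul_right]

end CentralLimit

/-! ### Double robustness -/

section DoubleRobustness

theorem aestronglyMeasurable_of_tendsto_ae_of_le {α E : Type*} [TopologicalSpace E] [Nonempty E]
    [TopologicalSpace.IsCompletelyMetrizableSpace E] {m m₀ : MeasurableSpace α} {μ : Measure α}
    {xs : ℕ → α → E} {x : α → E} (hxs : ∀ n, StronglyMeasurable[m] (xs n))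
    (hx : ∀ᵐ a ∂μ, Tendsto (xs · a) atTop (𝓝 (x a))) : AEStronglyMeasurable[m] x μ := by
  have := TopologicalSpace.t2Space_of_metrizableSpace (X := E)
  refine ⟨fun a => limUnder atTop (xs · a),
    @StronglyMeasurable.limUnder _ _ _ m _ _ _ _ _ _ _ hxs, ?_⟩
  filter_upwards [hx] with a ha using ha.limUnder_eq.symm

variable {α E : Type*} [NormedAddCommGroup E] [NormedSpace ℝ E]

/-- The augmented inverse probability weighted version `(R / π) x - ((R - π) / π) h` of a full-data
function `x`, with working propensity `π` and working outcome model `h`. -/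
noncomputable def aipw (R π : α → ℝ) (x h : α → E) : α → E :=
  fun a => (R a / π a) • x a - ((R a - π a) / π a) • h a

theorem aipw_const_smul_sub (R π : α → ℝ) (c : ℝ) (x x' h h' : α → E) :
    aipw R π (c • (x - x')) (c • (h - h')) = c • (aipw R π x h - aipw R π x' h') := by
  ext a
  simp only [aipw, Pi.smul_apply, Pi.sub_apply]
  module

theorem eq_sub_smul_limUnder {y h : ℕ → E} {b : ℝ} {y₀ u : E} (hy : Tendsto y atTop (𝓝 y₀))
    (hu : Tendsto (fun n => y n - b • h n) atTop (𝓝 u)) : u = y₀ - b • limUnder atTop h := by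
  obtain rfl | hb := eq_or_ne b 0
  · simpa using tendsto_nhds_unique hu (by simpa using hy)
  · have hh : Tendsto h atTop (𝓝 (b⁻¹ • (y₀ - u))) :=
      ((hy.sub hu).const_smul b⁻¹).congr fun n => by simp [smul_smul, hb]
    rw [hh.limUnder_eq, smul_inv_smul₀ hb]
    abel

variable {m₁ m₂ m₀ : MeasurableSpace α} {μ : Measure α} {R π₀ π : α → ℝ} {x h : α → E}

theorem ae_eq_aipw_limUnder {xs hs : ℕ → α → E} {u : α → E}
    (hx : ∀ᵐ a ∂μ, Tendsto (xs · a) atTop (𝓝 (x a)))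
    (hu : ∀ᵐ a ∂μ, Tendsto (fun n => aipw R π (xs n) (hs n) a) atTop (𝓝 (u a))) :
    u =ᵐ[μ] aipw R π x fun a => limUnder atTop (hs · a) := by
  filter_upwards [hx, hu] with a hxa hua
  exact eq_sub_smul_limUnder (hxa.const_smul _) hua

/-- Missingness at random: the observation indicator `R` has conditional mean `π₀` given the full
data `m₂`, and this propensity depends on the covariates `m₁` only. The indicator is encoded
as any essentially bounded function. -/
structure HasPropensity (μ : Measure α) (R π₀ : α → ℝ) (m₁ m₂ : MeasurableSpace α) : Prop where
  le_full : m₁ ≤ m₂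
  full_le : m₂ ≤ m₀
  memLp_top : MemLp R ⊤ μ
  stronglyMeasurable : StronglyMeasurable[m₁] π₀
  condExp_eq : μ[R | m₂] =ᵐ[μ] π₀

variable [IsFiniteMeasure μ]

theorem HasPropensity.integrable (H : HasPropensity μ R π₀ m₁ m₂) : Integrable R μ :=
  H.memLp_top.integrable le_top

theorem HasPropensity.condExp (H : HasPropensity μ R π₀ m₁ m₂) : μ[R | m₁] =ᵐ[μ] π₀ := by
  have hm := H.le_full.trans H.full_le
  calc μ[R | m₁] =ᵐ[μ] μ[μ[R | m₂] | m₁] := (condExp_condExp_of_le H.le_full H.full_le).symm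
    _ =ᵐ[μ] μ[π₀ | m₁] := condExp_congr_ae H.condExp_eq
    _ =ᵐ[μ] π₀ := by
      rw [condExp_of_stronglyMeasurable hm H.stronglyMeasurable
        (integrable_condExp.congr H.condExp_eq)]

variable [CompleteSpace E]

theorem HasPropensity.condExp_smul (H : HasPropensity μ R π₀ m₁ m₂)
    (hxm : AEStronglyMeasurable[m₂] x μ) (hxi : Integrable x μ) :
    μ[R • x | m₁] =ᵐ[μ] π₀ • μ[x | m₁] := by
  have hfull : μ[R • x | m₂] =ᵐ[μ] π₀ • x :=
    (condExp_smul_of_aestronglyMeasurable_right H.integrable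
      (hxi.smul_of_top_right H.memLp_top) hxm).trans (H.condExp_eq.smul EventuallyEq.rfl)
  calc μ[R • x | m₁] =ᵐ[μ] μ[μ[R • x | m₂] | m₁] :=
      (condExp_condExp_of_le H.le_full H.full_le).symm
    _ =ᵐ[μ] μ[π₀ • x | m₁] := condExp_congr_ae hfull
    _ =ᵐ[μ] π₀ • μ[x | m₁] :=
      condExp_smul_of_aestronglyMeasurable_left H.stronglyMeasurable.aestronglyMeasurable
        (integrable_condExp.congr hfull) hxi

theorem smul_condExp_aipw (H : HasPropensity μ R π₀ m₁ m₂) (hπ : StronglyMeasurable[m₁] π)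
    (hπ0 : ∀ a, π a ≠ 0) (hxm : AEStronglyMeasurable[m₂] x μ) (hxi : Integrable x μ)
    (hh : AEStronglyMeasurable[m₁] h μ) (hui : Integrable (aipw R π x h) μ)
    {c : α → ℝ} (hc : StronglyMeasurable[m₁] c) (hcL : MemLp c ⊤ μ) (hcπL : MemLp (c * π) ⊤ μ) :
    (c * π) • μ[aipw R π x h | m₁] =ᵐ[μ] c • π₀ • μ[x | m₁] - (c * π₀ - c * π) • h := by
  have hRx := hxi.smul_of_top_right H.memLp_top
  have hcRx := hRx.smul_of_top_right hcL
  have hcR : Integrable (c * R) μ := H.integrable.smul_of_top_right hcL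
  have hcπ := hcπL.integrable le_top
  have hcu := hui.smul_of_top_right hcπL
  have hsplit : (c * R - c * π) • h = c • R • x - (c * π) • aipw R π x h := by
    ext a
    have := hπ0 a
    simp only [aipw, Pi.smul_apply', Pi.mul_apply, Pi.sub_apply]
    match_scalars <;> field_simp
    ring
  have hweight : μ[c * R - c * π | m₁] =ᵐ[μ] c * π₀ - c * π := by
    refine (condExp_sub hcR hcπ m₁).trans (EventuallyEq.sub ?_ ?_)
    · exact (condExp_mul_of_stronglyMeasurable_left hc hcR H.integrable).trans
        ((EventuallyEq.refl _ c).mul H.condExp)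
    · rw [condExp_of_stronglyMeasurable (H.le_full.trans H.full_le) (hc.mul hπ) hcπ]
  have hresidual : (c * π₀ - c * π) • h
      =ᵐ[μ] c • π₀ • μ[x | m₁] - (c * π) • μ[aipw R π x h | m₁] := calc
    _ =ᵐ[μ] μ[c * R - c * π | m₁] • h := hweight.symm.smul .rfl
    _ =ᵐ[μ] μ[(c * R - c * π) • h | m₁] :=
      (condExp_smul_of_aestronglyMeasurable_right (hcR.sub hcπ) (hsplit ▸ hcRx.sub hcu) hh).symm
    _ =ᵐ[μ] μ[c • R • x | m₁] - μ[(c * π) • aipw R π x h | m₁] := by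
      rw [hsplit]
      exact condExp_sub hcRx hcu m₁
    _ =ᵐ[μ] c • μ[R • x | m₁] - (c * π) • μ[aipw R π x h | m₁] :=
      (condExp_smul_of_aestronglyMeasurable_left hc.aestronglyMeasurable hcRx hRx).sub
        (condExp_smul_of_aestronglyMeasurable_left (hc.mul hπ).aestronglyMeasurable hcu hui)
    _ =ᵐ[μ] c • π₀ • μ[x | m₁] - (c * π) • μ[aipw R π x h | m₁] :=
      ((EventuallyEq.refl _ c).smul (H.condExp_smul hxm hxi)).sub .rfl
  filter_upwards [hresidual] with a ha
  rw [Pi.sub_apply, ha, Pi.sub_apply, sub_sub_cancel]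

-- `h` and `R / π` need not be integrable, so the identity is multiplied by `π / (1 + π)` before
-- conditional expectations are taken termwise.
theorem condExp_aipw (H : HasPropensity μ R π₀ m₁ m₂) (hπ : StronglyMeasurable[m₁] π)
    (hπpos : ∀ a, 0 < π a) (hxm : AEStronglyMeasurable[m₂] x μ) (hxi : Integrable x μ)
    (hh : AEStronglyMeasurable[m₁] h μ) (hui : Integrable (aipw R π x h) μ) :
    π • μ[aipw R π x h | m₁] =ᵐ[μ] π₀ • μ[x | m₁] + (π - π₀) • h := by
  let c : α → ℝ := fun a => (1 + π a)⁻¹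
  have hc0 : ∀ a, c a ≠ 0 := fun a => inv_ne_zero (by linarith [hπpos a])
  have hc : StronglyMeasurable[m₁] c :=
    ((@measurable_const _ _ _ m₁ 1).add hπ.measurable).inv.stronglyMeasurable
  have hcL : MemLp c ⊤ μ :=
    memLp_top_of_bound (hc.mono (H.le_full.trans H.full_le)).aestronglyMeasurable 1
      (ae_of_all _ fun a => by
        have := hπpos a
        rw [Real.norm_of_nonneg (by positivity)]
        exact inv_le_one_of_one_le₀ (by linarith))
  have hcπL : MemLp (c * π) ⊤ μ := by
    convert (memLp_const (1 : ℝ)).sub hcL using 1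
    ext a
    have := hπpos a
    simp only [c, Pi.mul_apply, Pi.sub_apply]
    field_simp
    ring
  filter_upwards [smul_condExp_aipw H hπ (fun a => (hπpos a).ne') hxm hxi hh hui hc hcL hcπL]
    with a ha
  refine smul_right_injective E (hc0 a) ?_
  simp only [Pi.smul_apply', Pi.mul_apply, Pi.sub_apply, Pi.add_apply, mul_smul] at ha ⊢
  rw [ha]
  module

theorem integral_aipw_of_propensity (H : HasPropensity μ R π₀ m₁ m₂)
    (hπ : StronglyMeasurable[m₁] π) (hπpos : ∀ a, 0 < π a) (hππ₀ : π =ᵐ[μ] π₀)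
    (hxm : AEStronglyMeasurable[m₂] x μ) (hxi : Integrable x μ)
    (hh : AEStronglyMeasurable[m₁] h μ) (hui : Integrable (aipw R π x h) μ) :
    ∫ a, aipw R π x h a ∂μ = ∫ a, x a ∂μ := by
  have hm := H.le_full.trans H.full_le
  rw [← integral_condExp hm, ← integral_condExp hm (f := x)]
  refine integral_congr_ae ?_
  filter_upwards [condExp_aipw H hπ hπpos hxm hxi hh hui, hππ₀] with a ha hπa
  refine smul_right_injective E (hπpos a).ne' ?_
  simpa [hπa] using ha

theorem condExp_aipw_of_outcome (H : HasPropensity μ R π₀ m₁ m₂)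
    (hπ : StronglyMeasurable[m₁] π) (hπpos : ∀ a, 0 < π a) (hxh : μ[x | m₁] =ᵐ[μ] h)
    (hxm : AEStronglyMeasurable[m₂] x μ) (hxi : Integrable x μ)
    (hui : Integrable (aipw R π x h) μ) :
    μ[aipw R π x h | m₁] =ᵐ[μ] h := by
  have hh : AEStronglyMeasurable[m₁] h μ :=
    stronglyMeasurable_condExp.aestronglyMeasurable.congr hxh
  filter_upwards [condExp_aipw H hπ hπpos hxm hxi hh hui, hxh] with a ha hxa
  refine smul_right_injective E (hπpos a).ne' ?_
  simp only [Pi.smul_apply', Pi.sub_apply, Pi.add_apply, hxa] at ha ⊢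
  rw [ha]
  module

theorem integral_aipw_of_condExp_eq (H : HasPropensity μ R π₀ m₁ m₂) (hπ₀ : ∀ᵐ a ∂μ, π₀ a ≠ 0)
    (hπ : StronglyMeasurable[m₁] π) (hπpos : ∀ a, 0 < π a)
    (hxm : AEStronglyMeasurable[m₂] x μ) (hxi : Integrable x μ)
    (hui : Integrable (aipw R π x h) μ) (huh : μ[aipw R π x h | m₁] =ᵐ[μ] h) :
    ∫ a, aipw R π x h a ∂μ = ∫ a, x a ∂μ := by
  have hm := H.le_full.trans H.full_le
  have hh : AEStronglyMeasurable[m₁] h μ :=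
    stronglyMeasurable_condExp.aestronglyMeasurable.congr huh
  rw [← integral_condExp hm, ← integral_condExp hm (f := x)]
  refine integral_congr_ae ?_
  filter_upwards [condExp_aipw H hπ hπpos hxm hxi hh hui, huh, hπ₀] with a ha hua hπa
  refine smul_right_injective E hπa ?_
  simp only [Pi.smul_apply', Pi.sub_apply, Pi.add_apply, hua, sub_smul] at ha ⊢
  rw [add_sub_left_comm, left_eq_add, sub_eq_zero] at ha
  exact ha.symm

section Limits

variable {xs hs : ℕ → α → E} {u : α → E}

-- The limit model is identified along a subsequence: `hs n` is the conditional mean of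
-- `aipw R π (xs n) (hs n)`, which converges in `L¹`.
theorem ae_eq_aipw_condExp (H : HasPropensity μ R π₀ m₁ m₂) (hπ : StronglyMeasurable[m₁] π)
    (hπpos : ∀ a, 0 < π a) (hxs : ∀ n, StronglyMeasurable[m₂] (xs n))
    (hxsi : ∀ n, Integrable (xs n) μ) (hxh : ∀ n, μ[xs n | m₁] =ᵐ[μ] hs n)
    (husm : ∀ n, AEStronglyMeasurable (aipw R π (xs n) (hs n)) μ) {G : α → ℝ}
    (hG : Integrable G μ) (husG : ∀ n, ∀ᵐ a ∂μ, ‖aipw R π (xs n) (hs n) a‖ ≤ G a)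
    (hx : ∀ᵐ a ∂μ, Tendsto (xs · a) atTop (𝓝 (x a)))
    (hu : ∀ᵐ a ∂μ, Tendsto (fun n => aipw R π (xs n) (hs n) a) atTop (𝓝 (u a))) :
    u =ᵐ[μ] aipw R π x (μ[u | m₁]) := by
  have hm := H.le_full.trans H.full_le
  have hhs : ∀ n, μ[aipw R π (xs n) (hs n) | m₁] =ᵐ[μ] hs n := fun n =>
    condExp_aipw_of_outcome H hπ hπpos (hxh n) (hxs n).aestronglyMeasurable (hxsi n)
      (hG.mono' (husm n) (husG n))
  obtain ⟨ns, hns, hlim⟩ := (tendstoInMeasure_of_tendsto_Lp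
    (tendsto_condExpL1_of_dominated_convergence hm G husm hG husG hu)).exists_seq_tendsto_ae
  filter_upwards [hx, hu, hlim, condExp_ae_eq_condExpL1 hm u, ae_all_iff.2 hhs,
    ae_all_iff.2 fun n => condExp_ae_eq_condExpL1 hm (aipw R π (xs n) (hs n))]
    with a hxa hua hla hcu hhsa hcus
  have hsub : Tendsto (fun k => hs (ns k) a) atTop (𝓝 ((μ[u | m₁]) a)) := by
    simpa only [← hcu, ← hcus, hhsa] using hla
  exact tendsto_nhds_unique (hua.comp hns.tendsto_atTop)
    (((hxa.comp hns.tendsto_atTop).const_smul _).sub (hsub.const_smul _))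

theorem integral_eq_of_tendsto_aipw (H : HasPropensity μ R π₀ m₁ m₂)
    (hπ₀ : ∀ᵐ a ∂μ, π₀ a ≠ 0) (hπ : StronglyMeasurable[m₁] π) (hπpos : ∀ a, 0 < π a)
    (hxs : ∀ n, StronglyMeasurable[m₂] (xs n)) (hhs : ∀ n, StronglyMeasurable[m₁] (hs n))
    (hcorrect : π =ᵐ[μ] π₀ ∨ ∀ n, Integrable (xs n) μ ∧ μ[xs n | m₁] =ᵐ[μ] hs n)
    {G : α → ℝ} (hG : Integrable G μ) (husG : ∀ n, ∀ᵐ a ∂μ, ‖aipw R π (xs n) (hs n) a‖ ≤ G a)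
    (hxi : Integrable x μ) (hx : ∀ᵐ a ∂μ, Tendsto (xs · a) atTop (𝓝 (x a)))
    (hu : ∀ᵐ a ∂μ, Tendsto (fun n => aipw R π (xs n) (hs n) a) atTop (𝓝 (u a))) :
    ∫ a, u a ∂μ = ∫ a, x a ∂μ := by
  have hm := H.le_full.trans H.full_le
  have hxm : AEStronglyMeasurable[m₂] x μ := aestronglyMeasurable_of_tendsto_ae_of_le hxs hx
  have hπ' : AEStronglyMeasurable π μ := (hπ.mono hm).aestronglyMeasurable
  have hR := H.memLp_top.aestronglyMeasurable
  have husm : ∀ n, AEStronglyMeasurable (aipw R π (xs n) (hs n)) μ := fun n =>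
    (((hR.div₀ hπ').smul ((hxs n).mono H.full_le).aestronglyMeasurable)).sub
      (((hR.sub hπ').div₀ hπ').smul ((hhs n).mono hm).aestronglyMeasurable)
  have hui : Integrable u μ := by
    refine hG.mono' (aestronglyMeasurable_of_tendsto_ae _ husm hu) ?_
    filter_upwards [hu, ae_all_iff.2 husG] with a hua hGa using le_of_tendsto' hua.norm hGa
  obtain hππ₀ | hxh := hcorrect
  · have hu' := ae_eq_aipw_limUnder hx hu
    rw [integral_congr_ae hu', integral_aipw_of_propensity H hπ hπpos hππ₀ hxm hxi
      (@StronglyMeasurable.limUnder _ _ _ m₁ _ _ _ _ _ _ _ hhs).aestronglyMeasurable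
      (hui.congr hu')]
  · have hu' := ae_eq_aipw_condExp H hπ hπpos hxs (fun n => (hxh n).1) (fun n => (hxh n).2)
      husm hG husG hx hu
    rw [integral_congr_ae hu', integral_aipw_of_condExp_eq H hπ₀ hπ hπpos hxm hxi
      (hui.congr hu') (condExp_congr_ae hu'.symm)]

end Limits

end DoubleRobustness

/-! ### The uniform law of large numbers -/

section UniformLaw

theorem norm_empiricalMean_sub_integral_le {α E : Type*} [MeasurableSpace α]
    {P : Measure α} [NormedAddCommGroup E] [NormedSpace ℝ E] {f g : α → E} {ρ : α → ℝ}
    (hf : Integrable f P) (hg : Integrable g P) (hρ : Integrable ρ P)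
    (hle : ∀ᵐ o ∂P, ‖f o - g o‖ ≤ ρ o) {x : ℕ → α}
    (hx : ∀ i, ‖f (x i) - g (x i)‖ ≤ ρ (x i)) (n : ℕ) :
    ‖empiricalMean x n f - ∫ o, f o ∂P‖
      ≤ empiricalMean x n ρ + ‖empiricalMean x n g - ∫ o, g o ∂P‖ + ∫ o, ρ o ∂P := by
  have hmean : ‖empiricalMean x n f - empiricalMean x n g‖ ≤ empiricalMean x n ρ := by
    rw [← empiricalMean_sub]
    exact norm_empiricalMean_le hx n
  have hint : ‖(∫ o, g o ∂P) - ∫ o, f o ∂P‖ ≤ ∫ o, ρ o ∂P := by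
    rw [norm_sub_rev, ← integral_sub hf hg]
    exact norm_integral_le_of_norm_le hρ hle
  calc ‖empiricalMean x n f - ∫ o, f o ∂P‖
      = ‖(empiricalMean x n f - empiricalMean x n g) + (empiricalMean x n g - ∫ o, g o ∂P)
          + ((∫ o, g o ∂P) - ∫ o, f o ∂P)‖ := by congr 1; abel
    _ ≤ _ := norm_add₃_le.trans (by gcongr)

variable {Ω α : Type*} [MeasurableSpace Ω] [MeasurableSpace α] [StandardBorelSpace α]
  {Pr : Measure Ω} {P : Measure α} {O : ℕ → Ω → α} [IsFiniteMeasure P]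
  {Y E : Type*} [MetricSpace Y] [MeasurableSpace Y] [BorelSpace Y] [StandardBorelSpace Y]
  [NormedAddCommGroup E] [MeasurableSpace E] [BorelSpace E] [SecondCountableTopology E]
  {F : α → Y → E} {B : Set Y} {H : α → ℝ}

theorem exists_integrable_oscillation_bound (hF : Measurable fun x : α × Y => F x.1 x.2)
    (hB : MeasurableSet B) (hH : Integrable H P) (hFH : ∀ᵐ o ∂P, ∀ y ∈ B, ‖F o y‖ ≤ H o)
    {y : Y} (hy : y ∈ B) (hcont : ∀ᵐ o ∂P, ContinuousWithinAt (F o) B y) {ε : ℝ} (hε : 0 < ε) :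
    ∃ δ > 0, ∃ ρ : α → ℝ, Integrable ρ P ∧ ∫ o, ρ o ∂P < ε ∧
      ∀ᵐ o ∂P, ∀ y' ∈ B, dist y' y < δ → ‖F o y' - F o y‖ ≤ ρ o := by
  have hFy : Measurable fun x : α × Y => F x.1 y := hF.comp (measurable_fst.prodMk measurable_const)
  have hbound : ∀ᵐ o ∂P, ∀ y' ∈ B, ‖F o y' - F o y‖ ≤ H o + H o := by
    filter_upwards [hFH] with o ho y' hy'
    exact (norm_sub_le _ _).trans (add_le_add (ho y' hy') (ho y hy))
  have hshrink : ∀ᵐ o ∂P, ∀ η > 0, ∃ k : ℕ, ∀ y' ∈ B ∩ Metric.ball y (1 / ((k : ℝ) + 1)),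
      ‖F o y' - F o y‖ ≤ η := by
    filter_upwards [hcont] with o ho η hη
    obtain ⟨δ, hδ, hδ'⟩ := Metric.continuousWithinAt_iff.1 ho η hη
    obtain ⟨k, hk⟩ := exists_nat_one_div_lt hδ
    refine ⟨k, fun y' hy' => ?_⟩
    rw [← dist_eq_norm]
    exact (hδ' hy'.1 (lt_trans hy'.2 hk)).le
  obtain ⟨k, ρ, hρ, hρε, hle⟩ := exists_integrable_majorant_integral_lt P
    (g := fun o y' => ‖F o y' - F o y‖) (hF.sub hFy).norm
    (fun k => hB.inter measurableSet_ball)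
    (fun a b hab => Set.inter_subset_inter_right _
      (Metric.ball_subset_ball (Nat.one_div_le_one_div hab)))
    (hH.add hH) (hbound.mono fun o ho y' hy' => ho y' hy'.1) hshrink hε
  refine ⟨1 / ((k : ℝ) + 1), by positivity, ρ, hρ, hρε, ?_⟩
  filter_upwards [hle] with o ho y' hy' hd using ho y' ⟨hy', hd⟩

theorem exists_finset_oscillation_cover (hF : Measurable fun x : α × Y => F x.1 x.2)
    (hB : IsCompact B) (hH : Integrable H P) (hFH : ∀ᵐ o ∂P, ∀ y ∈ B, ‖F o y‖ ≤ H o)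
    (hcont : ∀ y ∈ B, ∀ᵐ o ∂P, ContinuousWithinAt (F o) B y) {ε : ℝ} (hε : 0 < ε) :
    ∃ (t : Finset Y) (c : Y → Y) (ρ : Y → α → ℝ), (∀ y ∈ t, y ∈ B) ∧ (∀ y ∈ B, c y ∈ t) ∧
      (∀ y ∈ t, Integrable (ρ y) P ∧ ∫ o, ρ y o ∂P < ε) ∧
      ∀ᵐ o ∂P, ∀ y ∈ B, ‖F o y - F o (c y)‖ ≤ ρ (c y) o := by
  choose! δ hδ ρ hρ hρε hle using fun y (hy : y ∈ B) =>
    exists_integrable_oscillation_bound hF hB.measurableSet hH hFH hy (hcont y hy) hε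
  obtain ⟨t, htB, ht⟩ := hB.elim_nhds_subcover (fun y => Metric.ball y (δ y))
    fun y hy => Metric.ball_mem_nhds y (hδ y hy)
  choose! c hct hc using fun y (hy : y ∈ B) =>
    show ∃ z ∈ t, dist y z < δ z by simpa using ht hy
  refine ⟨t, c, ρ, htB, hct, fun y hy => ⟨hρ y (htB y hy), hρε y (htB y hy)⟩, ?_⟩
  filter_upwards [(ae_ball_iff t.countable_toSet).2 fun z hz => hle z (htB z hz)] with o ho y hy
  exact ho (c y) (hct y hy) y hy (hc y hy)

theorem eventuallyLikely_uniform_empiricalMean [NormedSpace ℝ E] [CompleteSpace E]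
    [IsFiniteMeasure Pr]
    (hlaw : ∀ i, HasLaw (O i) P Pr) (hindep : Pairwise fun i j => IndepFun (O i) (O j) Pr)
    (hF : Measurable fun x : α × Y => F x.1 x.2) (hB : IsCompact B) (hH : Integrable H P)
    (hFH : ∀ᵐ o ∂P, ∀ y ∈ B, ‖F o y‖ ≤ H o)
    (hcont : ∀ y ∈ B, ∀ᵐ o ∂P, ContinuousWithinAt (F o) B y) {ε : ℝ} (hε : 0 < ε) :
    EventuallyLikely Pr fun n ω => ∀ y ∈ B,
      ‖empiricalMean (O · ω) n (F · y) - ∫ o, F o y ∂P‖ < ε := by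
  have hFy : ∀ y ∈ B, Integrable (F · y) P := fun y hy =>
    hH.mono' (hF.comp (measurable_id.prodMk measurable_const)).aestronglyMeasurable
      (hFH.mono fun o ho => ho y hy)
  have hε4 : 0 < ε / 4 := by linarith
  obtain ⟨t, c, ρ, htB, hct, hρ, hle⟩ := exists_finset_oscillation_cover hF hB hH hFH hcont hε4
  have hmeanF := EventuallyLikely.finset_forall t fun y hy =>
    eventuallyLikely_empiricalMean hlaw hindep (hFy y (htB y hy)) hε4
  have hmeanρ := EventuallyLikely.finset_forall t fun y hy =>
    eventuallyLikely_empiricalMean hlaw hindep (hρ y hy).1 hε4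
  refine (hmeanF.and hmeanρ).mono (Eventually.of_forall fun n => ?_)
  filter_upwards [ae_forall_sample hlaw hle] with ω hω ⟨hωF, hωρ⟩ y hy
  have hbound := norm_empiricalMean_sub_integral_le (hFy y hy) (hFy _ (htB _ (hct y hy)))
    (hρ _ (hct y hy)).1 (hle.mono fun o ho => ho y hy) (fun i => hω i y hy) n
  have hρ_mean := (abs_lt.1 (hωρ _ (hct y hy))).2
  linarith [hωF _ (hct y hy), (hρ _ (hct y hy)).2]

end UniformLaw

/-! ### The estimating function -/

section EstimatingFunction

variable {d p q : ℕ}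

@[fun_prop]
theorem measurable_z1 : Measurable (z1 : Obs d → Fin d → ℝ) := measurable_fst

@[fun_prop]
theorem measurable_z2 : Measurable (z2 : Obs d → ℝ) := measurable_fst.comp measurable_snd

@[fun_prop]
theorem measurable_rInd : Measurable (rInd : Obs d → ℝ) :=
  (measurable_from_top (f := fun b : Bool => if b then (1 : ℝ) else 0)).comp
    (measurable_snd.comp measurable_snd)

theorem rInd_eq_zero_or_one (o : Obs d) : rInd o = 0 ∨ rInd o = 1 := by
  unfold rInd
  split_ifs <;> simp

theorem sigmaZ1_le_sigmaZ : sigmaZ1 d ≤ sigmaZ d := by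
  have : (z1 : Obs d → Fin d → ℝ) = Prod.fst ∘ fun o : Obs d => (z1 o, z2 o) := rfl
  rw [sigmaZ1, this, ← MeasurableSpace.comap_comp]
  exact MeasurableSpace.comap_mono measurable_fst.comap_le

theorem sigmaZ_le : sigmaZ d ≤ (inferInstance : MeasurableSpace (Obs d)) :=
  (measurable_z1.prodMk measurable_z2).comap_le

theorem MissingAtRandom.exists_hasPropensity {P : Measure (Obs d)} [IsFiniteMeasure P]
    (hMAR : MissingAtRandom P) :
    ∃ π₀ : Obs d → ℝ, HasPropensity P rInd π₀ (sigmaZ1 d) (sigmaZ d) ∧ ∀ᵐ o ∂P, π₀ o ≠ 0 := by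
  obtain ⟨π₀, hπ₀, hπ₀pos, hR⟩ := hMAR
  refine ⟨fun o => π₀ (z1 o), ⟨sigmaZ1_le_sigmaZ, sigmaZ_le, ?_,
    (hπ₀.comp (comap_measurable z1)).stronglyMeasurable, hR⟩, hπ₀pos.mono fun o ho => ho.ne'⟩
  refine memLp_top_of_bound measurable_rInd.aestronglyMeasurable 1 (ae_of_all _ fun o => ?_)
  rcases rInd_eq_zero_or_one o with h | h <;> simp [h]

variable (M : Ingredients d p q) (P : Measure (Obs d)) (β₀ : Vec 2)

theorem measurable_mPsi :
    Measurable fun x : Obs d × Vec 2 => mPsi M P β₀ x.1 x.2 := by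
  have hres : Measurable fun x : Obs d × Vec 2 => (z2 x.1 - x.2 0) / x.2 1 := by
    fun_prop
  refine (WithLp.measurable_toLp 2 (Fin 2 → ℝ)).comp (measurable_pi_iff.2 fun k => ?_)
  fin_cases k
  · exact (M.measurable_psiMu.comp hres).sub_const _
  · exact ((M.measurable_psiSigma.comp hres).pow_const 2).sub_const _

theorem measurable_phi :
    Measurable fun x : Obs d × Vec 2 × Vec p × Vec q => phi M P β₀ x.1 x.2.1 x.2.2.1 x.2.2.2 := by
  have hprop : Measurable fun x : Obs d × Vec 2 × Vec p × Vec q => M.prop (z1 x.1) x.2.2.1 :=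
    M.measurable_prop.comp (f := fun x : Obs d × Vec 2 × Vec p × Vec q => (z1 x.1, x.2.2.1))
      (by fun_prop)
  have hh : Measurable fun x : Obs d × Vec 2 × Vec p × Vec q => M.h (z1 x.1) x.2.1 x.2.2.2 :=
    M.measurable_h.comp
      (f := fun x : Obs d × Vec 2 × Vec p × Vec q => (z1 x.1, x.2.1, x.2.2.2)) (by fun_prop)
  have hm : Measurable fun x : Obs d × Vec 2 × Vec p × Vec q => mPsi M P β₀ x.1 x.2.1 :=
    (measurable_mPsi M P β₀).comp
      (f := fun x : Obs d × Vec 2 × Vec p × Vec q => (x.1, x.2.1)) (by fun_prop)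
  unfold phi
  fun_prop

theorem stronglyMeasurable_mPsi_sigmaZ (β : Vec 2) :
    StronglyMeasurable[sigmaZ d] fun o => mPsi M P β₀ o β :=
  (((measurable_mPsi M P β₀).comp (f := fun z : (Fin d → ℝ) × ℝ => ((z.1, z.2, true), β))
    (by fun_prop)).comp (comap_measurable fun o : Obs d => (z1 o, z2 o))).stronglyMeasurable

theorem stronglyMeasurable_h_sigmaZ1 (β : Vec 2) (ξ : Vec q) :
    StronglyMeasurable[sigmaZ1 d] fun o : Obs d => M.h (z1 o) β ξ :=
  ((M.measurable_h.comp (f := fun z : Fin d → ℝ => (z, β, ξ)) (by fun_prop)).comp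
    (comap_measurable z1)).stronglyMeasurable

theorem stronglyMeasurable_prop_sigmaZ1 (γ : Vec p) :
    StronglyMeasurable[sigmaZ1 d] fun o : Obs d => M.prop (z1 o) γ :=
  ((M.measurable_prop.comp (f := fun z : Fin d → ℝ => (z, γ)) (by fun_prop)).comp
    (comap_measurable z1)).stronglyMeasurable

variable {M P β₀} {γs : Vec p} {ξs : Vec q} {B : Set (Vec 2)}

theorem OutcomeCorrect.const_smul_sub (hout : OutcomeCorrect M P β₀ B ξs) {β β' : Vec 2}
    (hβ : β ∈ B) (hβ' : β' ∈ B) (c : ℝ) :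
    Integrable (c • ((mPsi M P β₀ · β) - (mPsi M P β₀ · β'))) P ∧
      P[c • ((mPsi M P β₀ · β) - (mPsi M P β₀ · β')) | sigmaZ1 d]
        =ᵐ[P] c • ((fun o => M.h (z1 o) β ξs) - fun o => M.h (z1 o) β' ξs) := by
  obtain ⟨hi, hce⟩ := hout β hβ
  obtain ⟨hi', hce'⟩ := hout β' hβ'
  exact ⟨(hi.sub hi').smul c, (condExp_smul c _ _).trans
    (((condExp_sub hi hi' _).trans (hce.sub hce')).const_smul c)⟩

theorem integral_phi_eq_integral_mPsi [IsFiniteMeasure P] (hMAR : MissingAtRandom P)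
    (hcorrect : PropensityCorrect M P γs ∨ OutcomeCorrect M P β₀ B ξs) {β : Vec 2} (hβ : β ∈ B)
    (hphi : Integrable (fun o => phi M P β₀ o β γs ξs) P)
    (hm : Integrable (fun o => mPsi M P β₀ o β) P) :
    ∫ o, phi M P β₀ o β γs ξs ∂P = ∫ o, mPsi M P β₀ o β ∂P := by
  obtain ⟨π₀, H, hπ₀⟩ := hMAR.exists_hasPropensity
  exact integral_eq_of_tendsto_aipw (xs := fun _ o => mPsi M P β₀ o β)
    (hs := fun _ o => M.h (z1 o) β ξs) H hπ₀ (stronglyMeasurable_prop_sigmaZ1 M γs)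
    (fun o => M.prop_pos (z1 o) γs) (fun _ => stronglyMeasurable_mPsi_sigmaZ M P β₀ β)
    (fun _ => stronglyMeasurable_h_sigmaZ1 M β ξs)
    (hcorrect.imp (fun h => h.symm.trans H.condExp) fun h _ => h β hβ) hphi.norm
    (fun _ => ae_of_all _ fun _ => le_rfl) hm (ae_of_all _ fun _ => tendsto_const_nhds)
    (ae_of_all _ fun _ => tendsto_const_nhds)

end EstimatingFunction

/-! ### Consistency -/

section WellSeparation

theorem exists_pos_forall_norm_lt_imp_dist_lt {X E : Type*} [PseudoMetricSpace X]
    [NormedAddCommGroup E] {f : X → E} {B : Set X} {x₀ : X} (hB : IsCompact B)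
    (hf : ContinuousOn f B) (hzero : ∀ x ∈ B, f x = 0 → x = x₀) {ε : ℝ} (hε : 0 < ε) :
    ∃ η > 0, ∀ x ∈ B, ‖f x‖ < η → dist x x₀ < ε := by
  obtain ⟨η, hη, hle⟩ := (hB.diff Metric.isOpen_ball).exists_forall_le'
    (hf.mono (Set.sdiff_subset (t := Metric.ball x₀ ε))).norm (a := 0) fun x hx =>
      norm_pos_iff.2 fun h0 => hx.2 (by simpa [hzero x hx.1 h0] using hε)
  refine ⟨η, hη, fun x hx hlt => ?_⟩
  by_contra hfar
  exact absurd (hle x ⟨hx, hfar⟩) (not_le.2 hlt)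

end WellSeparation

section StochasticProduct

variable {Ω α : Type*} [MeasurableSpace Ω] [MeasurableSpace α] {Pr : Measure Ω} [IsFiniteMeasure Pr]
  {P : Measure α} {O : ℕ → Ω → α}

theorem eventuallyLikely_empiricalMean_mul_lt (hlaw : ∀ i, HasLaw (O i) P Pr)
    (hindep : Pairwise fun i j => IndepFun (O i) (O j) Pr) {G : α → ℝ} (hG : Integrable G P)
    {Y : ℕ → Ω → ℝ} (hY : TendstoInMeasure Pr Y atTop fun _ => 0) {ε : ℝ} (hε : 0 < ε) :
    EventuallyLikely Pr fun n ω => empiricalMean (O · ω) n G * Y n ω < ε := by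
  set C := |∫ o, G o ∂P| + 1
  have hC : 0 < C := by positivity
  refine ((eventuallyLikely_empiricalMean hlaw hindep hG one_pos).and
    (tendstoInMeasure_const_iff_eventuallyLikely.1 hY (ε / C) (by positivity))).mono'
    fun n ω ⟨hmean, hYω⟩ => ?_
  have hmeanC : |empiricalMean (O · ω) n G| ≤ C := by
    have := abs_sub_abs_le_abs_sub (empiricalMean (O · ω) n G) (∫ o, G o ∂P)
    rw [Real.norm_eq_abs] at hmean
    linarith
  rw [sub_zero, Real.norm_eq_abs] at hYω
  calc empiricalMean (O · ω) n G * Y n ω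
      ≤ |empiricalMean (O · ω) n G| * |Y n ω| := (le_abs_self _).trans_eq (abs_mul _ _)
    _ ≤ C * |Y n ω| := by gcongr
    _ < C * (ε / C) := by gcongr
    _ = ε := by field_simp

end StochasticProduct

section Consistency

variable {d p q : ℕ} {M : Ingredients d p q} {P : Measure (Obs d)} {β₀ : Vec 2}
  {γs : Vec p} {ξs : Vec q} {B : Set (Vec 2)}

theorem Qhat_eq_norm_empiricalMean_sq (n : ℕ) (o : ℕ → Obs d) (β : Vec 2) (γ : Vec p)
    (ξ : Vec q) :
    Qhat M P β₀ n o β γ ξ = ‖empiricalMean o n fun o => phi M P β₀ o β γ ξ‖ ^ 2 := by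
  rw [Qhat, empiricalMean, norm_smul, mul_pow]
  simp

theorem norm_empiricalMean_le_of_Qhat_le {n : ℕ} {o : ℕ → Obs d} {β β' : Vec 2} {γ : Vec p}
    {ξ : Vec q} (h : Qhat M P β₀ n o β γ ξ ≤ Qhat M P β₀ n o β' γ ξ) :
    ‖empiricalMean o n fun o => phi M P β₀ o β γ ξ‖
      ≤ ‖empiricalMean o n fun o => phi M P β₀ o β' γ ξ‖ := by
  rw [Qhat_eq_norm_empiricalMean_sq, Qhat_eq_norm_empiricalMean_sq] at h
  exact (sq_le_sq₀ (norm_nonneg _) (norm_nonneg _)).1 h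

theorem norm_vec_two_le (v : Vec 2) : ‖v‖ ≤ |v 0| + |v 1| := by
  rw [EuclideanSpace.norm_eq, Fin.sum_univ_two, Real.norm_eq_abs, Real.norm_eq_abs]
  refine Real.sqrt_le_iff.2 ⟨by positivity, ?_⟩
  nlinarith [abs_nonneg (v 0), abs_nonneg (v 1)]

theorem abs_le_one_add_of_sq_le {a b : ℝ} (h : a ^ 2 ≤ b) : |a| ≤ 1 + b := by
  rw [← sq_abs] at h
  nlinarith [sq_nonneg (|a| - 1)]

theorem ConsistencyConditions.exists_mPsi_envelope [IsFiniteMeasure P]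
    (hC : ConsistencyConditions M P β₀ γs ξs B) :
    ∃ H : Obs d → ℝ, Integrable H P ∧ ∀ᵐ o ∂P, ∀ β ∈ B, ‖mPsi M P β₀ o β‖ ≤ H o := by
  obtain ⟨G₁, hG₁, hle₁⟩ := hC.moment_psiMu
  obtain ⟨G₂, hG₂, hle₂⟩ := hC.moment_psiSigma
  refine ⟨fun o => (1 + G₁ o + |constA M P β₀|) + (1 + G₂ o + |constB M P β₀|), by fun_prop, ?_⟩
  filter_upwards [hle₁, hle₂] with o ho₁ ho₂ β hβ
  refine (norm_vec_two_le _).trans (add_le_add ((abs_sub _ _).trans ?_) ((abs_sub _ _).trans ?_))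
  · gcongr
    exact abs_le_one_add_of_sq_le (by simpa only [sq_abs] using ho₁ β hβ)
  · gcongr
    exact abs_le_one_add_of_sq_le (by simpa only [sq_abs] using ho₂ β hβ)

theorem ConsistencyConditions.exists_h_envelope [IsFiniteMeasure P]
    (hC : ConsistencyConditions M P β₀ γs ξs B) :
    ∃ H : Obs d → ℝ, Integrable H P ∧ ∀ᵐ o ∂P, ∀ β ∈ B, ‖M.h (z1 o) β ξs‖ ≤ H o := by
  obtain ⟨G₀, hG₀, hle₀⟩ := hC.moment_h 0
  obtain ⟨G₁, hG₁, hle₁⟩ := hC.moment_h 1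
  refine ⟨fun o => (1 + G₀ o) + (1 + G₁ o), by fun_prop, ?_⟩
  filter_upwards [hle₀, hle₁] with o ho₀ ho₁ β hβ
  exact (norm_vec_two_le _).trans (add_le_add (abs_le_one_add_of_sq_le (ho₀ β hβ))
    (abs_le_one_add_of_sq_le (ho₁ β hβ)))

theorem norm_phi_le {o : Obs d} {β : Vec 2} {γ : Vec p} {ξ : Vec q} {ε : ℝ} (hε : 0 < ε)
    (hlow : ε ≤ M.prop (z1 o) γ) (hhigh : M.prop (z1 o) γ ≤ 1) :
    ‖phi M P β₀ o β γ ξ‖ ≤ ε⁻¹ * ‖mPsi M P β₀ o β‖ + ε⁻¹ * ‖M.h (z1 o) β ξ‖ := by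
  have hpos := M.prop_pos (z1 o) γ
  have hweight : ∀ {a : ℝ}, |a| ≤ 1 → |a / M.prop (z1 o) γ| ≤ ε⁻¹ := fun {a} ha => by
    rw [abs_div, abs_of_pos hpos, ← one_div]
    exact div_le_div₀ zero_le_one ha hε hlow
  have hR : |rInd o| ≤ 1 ∧ |rInd o - M.prop (z1 o) γ| ≤ 1 := by
    rcases rInd_eq_zero_or_one o with h | h <;> rw [h, abs_le, abs_le] <;>
      constructor <;> constructor <;> linarith
  refine (norm_sub_le _ _).trans ?_
  rw [norm_smul, norm_smul, Real.norm_eq_abs, Real.norm_eq_abs]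
  gcongr
  · exact hweight hR.1
  · exact hweight hR.2

theorem ConsistencyConditions.exists_phi_envelope [IsFiniteMeasure P]
    (hC : ConsistencyConditions M P β₀ γs ξs B) :
    ∃ H : Obs d → ℝ, Integrable H P ∧ ∀ᵐ o ∂P, ∀ β ∈ B, ‖phi M P β₀ o β γs ξs‖ ≤ H o := by
  obtain ⟨Hm, hHm, hmle⟩ := hC.exists_mPsi_envelope
  obtain ⟨Hh, hHh, hhle⟩ := hC.exists_h_envelope
  obtain ⟨ε, hε, hoverlap⟩ := hC.overlap
  refine ⟨fun o => ε⁻¹ * Hm o + ε⁻¹ * Hh o, by fun_prop, ?_⟩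
  filter_upwards [hmle, hhle, hoverlap] with o hmo hho hπ β hβ
  refine (norm_phi_le hε hπ.1.le hπ.2).trans ?_
  have := hmo β hβ
  have := hho β hβ
  gcongr

theorem ConsistencyConditions.integrable_mPsi [IsFiniteMeasure P]
    (hC : ConsistencyConditions M P β₀ γs ξs B) {β : Vec 2} (hβ : β ∈ B) :
    Integrable (fun o => mPsi M P β₀ o β) P := by
  obtain ⟨H, hH, hle⟩ := hC.exists_mPsi_envelope
  exact hH.mono' ((measurable_mPsi M P β₀).comp
    (measurable_id.prodMk measurable_const)).aestronglyMeasurable (hle.mono fun o ho => ho β hβ)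

theorem ConsistencyConditions.integrable_phi [IsFiniteMeasure P]
    (hC : ConsistencyConditions M P β₀ γs ξs B) {β : Vec 2} (hβ : β ∈ B) :
    Integrable (fun o => phi M P β₀ o β γs ξs) P := by
  obtain ⟨H, hH, hle⟩ := hC.exists_phi_envelope
  exact hH.mono' ((measurable_phi M P β₀).comp (f := fun o : Obs d => (o, β, γs, ξs))
    (by fun_prop)).aestronglyMeasurable (hle.mono fun o ho => ho β hβ)

theorem ConsistencyConditions.ae_continuousWithinAt_mPsi
    (hC : ConsistencyConditions M P β₀ γs ξs B) {β : Vec 2} (hβ : β ∈ B) :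
    ∀ᵐ o ∂P, ContinuousWithinAt (mPsi M P β₀ o) B β := by
  filter_upwards [hC.continuous_psi β hβ] with o ho
  refine (PiLp.continuous_toLp 2 _).continuousAt.comp_continuousWithinAt
    (continuousWithinAt_pi.2 fun k => ?_)
  fin_cases k
  · exact ho.1.sub continuousWithinAt_const
  · exact (ho.2.pow 2).sub continuousWithinAt_const

theorem ConsistencyConditions.ae_continuousWithinAt_phi
    (hC : ConsistencyConditions M P β₀ γs ξs B) {β : Vec 2} (hβ : β ∈ B) :
    ∀ᵐ o ∂P, ContinuousWithinAt (fun b => phi M P β₀ o b γs ξs) B β := by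
  filter_upwards [hC.ae_continuousWithinAt_mPsi hβ, hC.continuous_h β hβ] with o hm hh
  exact (hm.const_smul (rInd o / M.prop (z1 o) γs)).sub
    (hh.const_smul ((rInd o - M.prop (z1 o) γs) / M.prop (z1 o) γs))

theorem ConsistencyConditions.continuousOn_integral_mPsi [IsFiniteMeasure P]
    (hC : ConsistencyConditions M P β₀ γs ξs B) :
    ContinuousOn (fun β => ∫ o, mPsi M P β₀ o β ∂P) B := by
  obtain ⟨H, hH, hle⟩ := hC.exists_mPsi_envelope
  refine fun β hβ => continuousWithinAt_of_dominated (bound := H)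
    (Eventually.of_forall fun β => ((measurable_mPsi M P β₀).comp
      (measurable_id.prodMk measurable_const)).aestronglyMeasurable) ?_ hH
    (hC.ae_continuousWithinAt_mPsi hβ)
  filter_upwards [self_mem_nhdsWithin] with β' hβ'
  exact hle.mono fun o ho => ho β' hβ'

theorem integral_mPsi_true_eq_zero [IsProbabilityMeasure P]
    (hm : Integrable (fun o => mPsi M P β₀ o β₀) P) : ∫ o, mPsi M P β₀ o β₀ ∂P = 0 := by
  ext k
  have hcoord := (EuclideanSpace.proj k : Vec 2 →L[ℝ] ℝ).integral_comp_comm hm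
  simp only [EuclideanSpace.coe_proj] at hcoord
  rw [← hcoord]
  fin_cases k
  · simpa [mPsi, constA, average_eq_integral] using
      integral_sub_average P fun o : Obs d => M.psi M.cMu ((z2 o - β₀ 0) / β₀ 1)
  · simpa [mPsi, constB, average_eq_integral] using
      integral_sub_average P fun o : Obs d => M.psi M.cSigma ((z2 o - β₀ 0) / β₀ 1) ^ 2

theorem differentiableAt_phi_gamma {o : Obs d} {γ : Vec p}
    (h : DifferentiableAt ℝ (M.prop (z1 o)) γ) (β : Vec 2) (ξ : Vec q) :
    DifferentiableAt ℝ (fun γ => phi M P β₀ o β γ ξ) γ := by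
  have hinv : DifferentiableAt ℝ (fun γ => (M.prop (z1 o) γ)⁻¹) γ :=
    h.fun_inv (M.prop_pos (z1 o) γ).ne'
  simp only [phi, div_eq_mul_inv]
  fun_prop

theorem differentiableAt_phi_xi {o : Obs d} {β : Vec 2} {ξ : Vec q}
    (h : DifferentiableAt ℝ (M.h (z1 o) β) ξ) (γ : Vec p) :
    DifferentiableAt ℝ (fun ξ => phi M P β₀ o β γ ξ) ξ := by
  unfold phi
  fun_prop

theorem ConsistencyConditions.exists_nuisance_lipschitz
    (hC : ConsistencyConditions M P β₀ γs ξs B) :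
    ∃ r > 0, ∃ G : Obs d → ℝ, Integrable G P ∧ ∀ᵐ o ∂P, ∀ β ∈ B,
      ∀ γ ∈ Metric.ball γs r, ∀ ξ ∈ Metric.ball ξs r,
        ‖phi M P β₀ o β γ ξ - phi M P β₀ o β γs ξs‖ ≤ G o * (‖γ - γs‖ + ‖ξ - ξs‖) := by
  obtain ⟨U, V, hU, hγU, hV, hξV, hπ, hh, ⟨G₁, hG₁, hle₁⟩, ⟨G₂, hG₂, hle₂⟩⟩ := hC.smooth_nuisance
  obtain ⟨r₁, hr₁, hr₁U⟩ := Metric.isOpen_iff.1 hU γs hγU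
  obtain ⟨r₂, hr₂, hr₂V⟩ := Metric.isOpen_iff.1 hV ξs hξV
  refine ⟨min r₁ r₂, lt_min hr₁ hr₂, fun o => |G₁ o| + |G₂ o|, by fun_prop, ?_⟩
  filter_upwards [hπ, hh, hle₁, hle₂] with o hπo hho ho₁ ho₂ β hβ γ hγ ξ hξ
  have hγ' := Metric.ball_subset_ball (min_le_left r₁ r₂) hγ
  have hξ' := Metric.ball_subset_ball (min_le_right r₁ r₂) hξ
  have hstepγ : ‖phi M P β₀ o β γ ξ - phi M P β₀ o β γs ξ‖ ≤ |G₁ o| * ‖γ - γs‖ :=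
    (convex_ball γs r₁).norm_image_sub_le_of_norm_fderiv_le (𝕜 := ℝ)
      (f := fun γ => phi M P β₀ o β γ ξ)
      (fun g hg => differentiableAt_phi_gamma
        ((hπo.differentiableOn one_ne_zero).differentiableAt (hU.mem_nhds (hr₁U hg))) β ξ)
      (fun g hg => (ho₁ (β, g, ξ) ⟨hβ, hr₁U hg, hr₂V hξ'⟩).trans (le_abs_self _))
      (Metric.mem_ball_self hr₁) hγ'
  have hstepξ : ‖phi M P β₀ o β γs ξ - phi M P β₀ o β γs ξs‖ ≤ |G₂ o| * ‖ξ - ξs‖ :=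
    (convex_ball ξs r₂).norm_image_sub_le_of_norm_fderiv_le (𝕜 := ℝ)
      (f := fun ξ => phi M P β₀ o β γs ξ)
      (fun x hx => differentiableAt_phi_xi
        (((hho β hβ).differentiableOn one_ne_zero).differentiableAt (hV.mem_nhds (hr₂V hx))) γs)
      (fun x hx => (ho₂ (β, γs, x) ⟨hβ, hγU, hr₂V hx⟩).trans (le_abs_self _))
      (Metric.mem_ball_self hr₂) hξ'
  calc ‖phi M P β₀ o β γ ξ - phi M P β₀ o β γs ξs‖
      ≤ |G₁ o| * ‖γ - γs‖ + |G₂ o| * ‖ξ - ξs‖ :=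
        (norm_sub_le_norm_sub_add_norm_sub _ _ _).trans (add_le_add hstepγ hstepξ)
    _ ≤ (|G₁ o| + |G₂ o|) * (‖γ - γs‖ + ‖ξ - ξs‖) := by
      nlinarith [mul_nonneg (abs_nonneg (G₁ o)) (norm_nonneg (ξ - ξs)),
        mul_nonneg (abs_nonneg (G₂ o)) (norm_nonneg (γ - γs))]

variable {Ω : Type*} [MeasurableSpace Ω] {Pr : Measure Ω} [IsFiniteMeasure Pr]
  {O : ℕ → Ω → Obs d} {γhat : ℕ → Ω → Vec p} {ξhat : ℕ → Ω → Vec q} {βhat : ℕ → Ω → Vec 2}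

theorem ConsistencyConditions.eventuallyLikely_nuisance
    (hC : ConsistencyConditions M P β₀ γs ξs B) (hlaw : ∀ i, HasLaw (O i) P Pr)
    (hindep : Pairwise fun i j => IndepFun (O i) (O j) Pr)
    (hγlim : TendstoInMeasure Pr γhat atTop fun _ => γs)
    (hξlim : TendstoInMeasure Pr ξhat atTop fun _ => ξs) {ε : ℝ} (hε : 0 < ε) :
    EventuallyLikely Pr fun n ω => ∀ β ∈ B,
      ‖empiricalMean (O · ω) n (fun o => phi M P β₀ o β (γhat n ω) (ξhat n ω))
        - empiricalMean (O · ω) n fun o => phi M P β₀ o β γs ξs‖ < ε := by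
  obtain ⟨r, hr, G, hG, hle⟩ := hC.exists_nuisance_lipschitz
  have hγ := tendstoInMeasure_const_iff_eventuallyLikely.1 hγlim
  have hξ := tendstoInMeasure_const_iff_eventuallyLikely.1 hξlim
  have herr : TendstoInMeasure Pr (fun n ω => ‖γhat n ω - γs‖ + ‖ξhat n ω - ξs‖) atTop
      fun _ => 0 := by
    refine tendstoInMeasure_const_iff_eventuallyLikely.2 fun δ hδ =>
      ((hγ _ (half_pos hδ)).and (hξ _ (half_pos hδ))).mono' fun n ω ⟨hγω, hξω⟩ => ?_
    rw [sub_zero, Real.norm_of_nonneg (by positivity)]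
    linarith [hγω, hξω]
  refine (((hγ r hr).and (hξ r hr)).and
    (eventuallyLikely_empiricalMean_mul_lt hlaw hindep hG herr hε)).mono
    (Eventually.of_forall fun n => ?_)
  filter_upwards [ae_forall_sample hlaw hle] with ω hω ⟨⟨hγω, hξω⟩, hsmall⟩ β hβ
  rw [← empiricalMean_sub]
  refine (norm_empiricalMean_le (g := fun o => G o * (‖γhat n ω - γs‖ + ‖ξhat n ω - ξs‖))
    (fun i => hω i β hβ _ (mem_ball_iff_norm.2 hγω) _ (mem_ball_iff_norm.2 hξω)) n).trans_lt ?_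
  rwa [empiricalMean_mul_const]

theorem ConsistencyConditions.tendstoInMeasure [IsProbabilityMeasure P]
    (hC : ConsistencyConditions M P β₀ γs ξs B) (hlaw : ∀ i, HasLaw (O i) P Pr)
    (hindep : Pairwise fun i j => IndepFun (O i) (O j) Pr) (hMAR : MissingAtRandom P)
    (hβhat : EventuallyLikely Pr fun n ω => βhat n ω ∈ B ∧ ∀ β ∈ B,
      Qhat M P β₀ n (fun i => O i ω) (βhat n ω) (γhat n ω) (ξhat n ω) ≤
        Qhat M P β₀ n (fun i => O i ω) β (γhat n ω) (ξhat n ω))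
    (hγlim : TendstoInMeasure Pr γhat atTop fun _ => γs)
    (hξlim : TendstoInMeasure Pr ξhat atTop fun _ => ξs)
    (hcorrect : PropensityCorrect M P γs ∨ OutcomeCorrect M P β₀ B ξs) :
    TendstoInMeasure Pr βhat atTop fun _ => β₀ := by
  obtain ⟨H, hH, hle⟩ := hC.exists_phi_envelope
  have hmean : ∀ β ∈ B, ∫ o, phi M P β₀ o β γs ξs ∂P = ∫ o, mPsi M P β₀ o β ∂P := fun β hβ =>
    integral_phi_eq_integral_mPsi hMAR hcorrect hβ (hC.integrable_phi hβ) (hC.integrable_mPsi hβ)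
  have hmean₀ : ∫ o, phi M P β₀ o β₀ γs ξs ∂P = 0 :=
    (hmean β₀ hC.mem).trans (integral_mPsi_true_eq_zero (hC.integrable_mPsi hC.mem))
  have hphim : Measurable fun x : Obs d × Vec 2 => phi M P β₀ x.1 x.2 γs ξs :=
    (measurable_phi M P β₀).comp (f := fun x : Obs d × Vec 2 => (x.1, x.2, γs, ξs)) (by fun_prop)
  refine tendstoInMeasure_const_iff_eventuallyLikely.2 fun ε hε => ?_
  obtain ⟨η, hη, hsep⟩ := exists_pos_forall_norm_lt_imp_dist_lt hC.compact
    hC.continuousOn_integral_mPsi hC.identification hε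
  have hη4 : 0 < η / 4 := by linarith
  refine ((hβhat.and (hC.eventuallyLikely_nuisance hlaw hindep hγlim hξlim hη4)).and
    (eventuallyLikely_uniform_empiricalMean hlaw hindep hphim hC.compact hH hle
      (fun β hβ => hC.ae_continuousWithinAt_phi hβ) hη4)).mono'
    fun n ω ⟨⟨⟨hmem, hmin⟩, hnuisance⟩, huniform⟩ => ?_
  rw [← dist_eq_norm]
  refine hsep _ hmem ?_
  rw [← hmean _ hmem]
  have hcriterion := norm_empiricalMean_le_of_Qhat_le (hmin β₀ hC.mem)
  have hnuisance_hat := hnuisance _ hmem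
  have hnuisance₀ := hnuisance _ hC.mem
  have huniform_hat := huniform _ hmem
  have huniform₀ := huniform _ hC.mem
  rw [hmean₀, sub_zero] at huniform₀
  set x := empiricalMean (O · ω) n fun o => phi M P β₀ o (βhat n ω) (γhat n ω) (ξhat n ω)
  set y := empiricalMean (O · ω) n fun o => phi M P β₀ o (βhat n ω) γs ξs
  have hlimit := norm_le_norm_add_norm_sub' (∫ o, phi M P β₀ o (βhat n ω) γs ξs ∂P) y
  have hhat := norm_le_norm_add_norm_sub' y x
  have htrue := norm_le_norm_add_norm_sub'
    (empiricalMean (O · ω) n fun o => phi M P β₀ o β₀ (γhat n ω) (ξhat n ω))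
    (empiricalMean (O · ω) n fun o => phi M P β₀ o β₀ γs ξs)
  rw [norm_sub_rev] at hlimit hhat
  linarith

end Consistency

/-! ### Asymptotic linearization of Z-estimators -/

section RandomDerivative

variable {α V E : Type*} [MeasurableSpace α] {P : Measure α} [NormedAddCommGroup V]
  [NormedSpace ℝ V] [FiniteDimensional ℝ V] [NormedAddCommGroup E] [NormedSpace ℝ E]
  [FiniteDimensional ℝ E] {f : α → V → E} {x₀ : V}

theorem aestronglyMeasurable_clm_of_apply {D : α → V →L[ℝ] E}
    (hD : ∀ v, AEStronglyMeasurable (fun a => D a v) P) : AEStronglyMeasurable D P := by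
  let b := Module.finBasis ℝ V
  let T := (b.constr ℝ (M' := E)).trans (LinearMap.toContinuousLinearMap (𝕜 := ℝ))
  have hT : D = fun a => T fun i => D a (b i) := by
    ext1 a
    refine ContinuousLinearMap.coe_injective (b.ext fun i => ?_)
    simp [T]
  rw [hT]
  borelize E
  have : ProperSpace E := FiniteDimensional.proper_real E
  exact T.toLinearMap.continuous_of_finiteDimensional.comp_aestronglyMeasurable
    (aemeasurable_pi_iff.2 fun i => (hD (b i)).aemeasurable).aestronglyMeasurable

theorem aestronglyMeasurable_fderiv (hf : ∀ x, AEStronglyMeasurable (f · x) P)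
    (hd : ∀ᵐ a ∂P, DifferentiableAt ℝ (f a) x₀) :
    AEStronglyMeasurable (fun a => fderiv ℝ (f a) x₀) P := by
  refine aestronglyMeasurable_clm_of_apply fun v => ?_
  refine aestronglyMeasurable_of_tendsto_ae atTop
    (f := fun (n : ℕ) a => (n : ℝ) • (f a (x₀ + (n : ℝ)⁻¹ • v) - f a x₀))
    (fun n => ((hf _).sub (hf _)).const_smul _) ?_
  filter_upwards [hd] with a ha
  exact ha.hasFDerivAt.lim _ (by simpa using tendsto_natCast_atTop_atTop)

theorem integrable_fderiv (hf : ∀ x, AEStronglyMeasurable (f · x) P)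
    (hd : ∀ᵐ a ∂P, DifferentiableAt ℝ (f a) x₀) {G : α → ℝ} (hG : Integrable G P)
    (hle : ∀ᵐ a ∂P, ‖fderiv ℝ (f a) x₀‖ ≤ G a) : Integrable (fun a => fderiv ℝ (f a) x₀) P :=
  hG.mono' (aestronglyMeasurable_fderiv hf hd) hle

end RandomDerivative

section RandomDerivative

theorem exists_nat_forall_mem_ball_norm_sub_sub_le {V E : Type*} [NormedAddCommGroup V]
    [NormedSpace ℝ V] [NormedAddCommGroup E] [NormedSpace ℝ E] {f : V → E} {D : V →L[ℝ] E}
    {x₀ : V} (hf : HasStrictFDerivAt f D x₀) (r : ℝ) {ε : ℝ} (hε : 0 < ε) :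
    ∃ k : ℕ, ∀ x ∈ Metric.ball x₀ (r / (k + 1)), ∀ y ∈ Metric.ball x₀ (r / (k + 1)),
      ‖f x - f y - D (x - y)‖ ≤ ε * ‖x - y‖ := by
  obtain ⟨s, hs, hfs⟩ := Metric.eventually_nhds_iff_ball.1 (hf.isLittleO.bound hε)
  obtain ⟨k, hk⟩ := ((tendsto_const_div_atTop_nhds_zero_nat r).comp
    (tendsto_add_atTop_nat 1)).eventually_lt_const hs |>.exists
  have hk : r / (k + 1) ≤ s := by simpa using hk.le
  refine ⟨k, fun x hx y hy => hfs (x, y) ?_⟩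
  rw [← ball_prod_same]
  exact ⟨Metric.ball_subset_ball hk hx, Metric.ball_subset_ball hk hy⟩

variable {α V E : Type*} [MeasurableSpace α] {P : Measure α} [NormedAddCommGroup V]
  [NormedSpace ℝ V] [FiniteDimensional ℝ V] [MeasurableSpace V] [BorelSpace V]
  [NormedAddCommGroup E] [NormedSpace ℝ E] [FiniteDimensional ℝ E] [MeasurableSpace E]
  [BorelSpace E] {f : α → V → E}

theorem measurable_norm_sub_sub_clm_div (hf : Measurable fun z : α × V => f z.1 z.2)
    {D : α → V →L[ℝ] E} (hD : StronglyMeasurable D) :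
    Measurable fun z : α × V × V =>
      ‖f z.1 z.2.1 - f z.1 z.2.2 - D z.1 (z.2.1 - z.2.2)‖ / ‖z.2.1 - z.2.2‖ := by
  have : ProperSpace E := FiniteDimensional.proper_real E
  have : ProperSpace V := FiniteDimensional.proper_real V
  have hf₁ : Measurable fun z : α × V × V => f z.1 z.2.1 :=
    hf.comp (measurable_fst.prodMk measurable_snd.fst)
  have hf₂ : Measurable fun z : α × V × V => f z.1 z.2.2 :=
    hf.comp (measurable_fst.prodMk measurable_snd.snd)
  have hsub : Measurable fun z : α × V × V => z.2.1 - z.2.2 := by fun_prop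
  have hDsub : Measurable fun z : α × V × V => D z.1 (z.2.1 - z.2.2) :=
    (isBoundedBilinearMap_apply.continuous.comp_stronglyMeasurable
      ((hD.comp_measurable measurable_fst).prodMk hsub.stronglyMeasurable)).measurable
  exact ((hf₁.sub hf₂).sub hDsub).norm.div hsub.norm

theorem norm_sub_sub_fderiv_div_le {V E : Type*} [NormedAddCommGroup V] [NormedSpace ℝ V]
    [NormedAddCommGroup E] [NormedSpace ℝ E] {f : V → E} {x₀ x y : V} {r C : ℝ}
    (hd : DifferentiableOn ℝ f (Metric.ball x₀ r))
    (hle : ∀ z ∈ Metric.ball x₀ r, ‖fderiv ℝ f z‖ ≤ C) (hx : x ∈ Metric.ball x₀ r)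
    (hy : y ∈ Metric.ball x₀ r) :
    ‖f x - f y - fderiv ℝ f x₀ (x - y)‖ / ‖x - y‖ ≤ C + C := by
  have hx₀ : ‖fderiv ℝ f x₀‖ ≤ C :=
    hle x₀ (Metric.mem_ball_self (dist_nonneg.trans_lt (Metric.mem_ball.1 hx)))
  have hC : 0 ≤ C := (norm_nonneg _).trans hx₀
  have hLip : ‖f x - f y‖ ≤ C * ‖x - y‖ :=
    (convex_ball x₀ r).norm_image_sub_le_of_norm_fderiv_le (𝕜 := ℝ)
      (fun z hz => hd.differentiableAt (Metric.isOpen_ball.mem_nhds hz)) hle hy hx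
  refine div_le_of_le_mul₀ (norm_nonneg _) (by positivity) ((norm_sub_le _ _).trans ?_)
  rw [add_mul]
  exact add_le_add hLip ((fderiv ℝ f x₀).le_of_opNorm_le hx₀ _)

theorem exists_integrable_strict_fderiv_modulus [StandardBorelSpace α] [IsFiniteMeasure P]
    (hf : Measurable fun z : α × V => f z.1 z.2) {x₀ : V} {N : Set V} (hN : N ∈ 𝓝 x₀)
    (hC1 : ∀ᵐ a ∂P, ContDiffOn ℝ 1 (f a) N) {G : α → ℝ} (hG : Integrable G P)
    (hle : ∀ᵐ a ∂P, ∀ x ∈ N, ‖fderiv ℝ (f a) x‖ ≤ G a) {η : ℝ} (hη : 0 < η) :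
    ∃ δ > 0, ∃ ρ : α → ℝ, Integrable ρ P ∧ ∫ a, ρ a ∂P < η ∧
      ∀ᵐ a ∂P, ∀ x ∈ Metric.ball x₀ δ, ∀ y ∈ Metric.ball x₀ δ,
        ‖f a x - f a y - fderiv ℝ (f a) x₀ (x - y)‖ ≤ ρ a * ‖x - y‖ := by
  have : ProperSpace V := FiniteDimensional.proper_real V
  obtain ⟨r, hr, hrN⟩ := Metric.mem_nhds_iff.1 hN
  have hD : AEStronglyMeasurable (fun a => fderiv ℝ (f a) x₀) P := by
    have : ProperSpace E := FiniteDimensional.proper_real E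
    refine aestronglyMeasurable_fderiv (fun x => ?_) ?_
    · exact (hf.comp (measurable_id.prodMk measurable_const)).aestronglyMeasurable
    · filter_upwards [hC1] with a ha using (ha.contDiffAt hN).differentiableAt one_ne_zero
  let S : ℕ → Set (V × V) := fun k =>
    Metric.ball x₀ (r / (k + 1)) ×ˢ Metric.ball x₀ (r / (k + 1))
  have hanti : Antitone S := fun i j hij => by
    have hij : Metric.ball x₀ (r / ((j : ℝ) + 1)) ⊆ Metric.ball x₀ (r / (i + 1)) :=
      Metric.ball_subset_ball (by gcongr)
    exact Set.prod_mono hij hij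
  let q : α → V × V → ℝ := fun a z =>
    ‖f a z.1 - f a z.2 - hD.mk _ a (z.1 - z.2)‖ / ‖z.1 - z.2‖
  obtain ⟨k, ρ, hρ, hρη, hρle⟩ := exists_integrable_majorant_integral_lt P (g := q)
    (measurable_norm_sub_sub_clm_div hf hD.stronglyMeasurable_mk) (S := S)
    (fun k => measurableSet_ball.prod measurableSet_ball) hanti (hG.add hG)
    (by
      filter_upwards [hD.ae_eq_mk, hC1, hle] with a hDa hda hlea z hz
      simp only [q, ← hDa]
      simp only [S, Nat.cast_zero, zero_add, div_one] at hz
      exact norm_sub_sub_fderiv_div_le ((hda.differentiableOn one_ne_zero).mono hrN)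
        (fun x hx => hlea x (hrN hx)) hz.1 hz.2)
    (by
      filter_upwards [hD.ae_eq_mk, hC1] with a hDa hda ε hε
      obtain ⟨k, hk⟩ := exists_nat_forall_mem_ball_norm_sub_sub_le
        ((hda.contDiffAt hN).hasStrictFDerivAt one_ne_zero) r hε
      simp only [q, ← hDa]
      exact ⟨k, fun z hz => div_le_of_le_mul₀ (norm_nonneg _) hε.le (hk _ hz.1 _ hz.2)⟩)
    hη
  refine ⟨r / (k + 1), by positivity, ρ, hρ, hρη, ?_⟩
  filter_upwards [hD.ae_eq_mk, hρle] with a hDa hρa x hx y hy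
  rcases eq_or_ne x y with rfl | hne
  · simp
  · rw [hDa]
    exact (div_le_iff₀ (norm_pos_iff.2 (sub_ne_zero.2 hne))).1 (hρa (x, y) ⟨hx, hy⟩)

end RandomDerivative

section AsymptoticStrictFDeriv

variable {Ω V E : Type*} [MeasurableSpace Ω] {Pr : Measure Ω} [NormedAddCommGroup V]
  [NormedSpace ℝ V] [NormedAddCommGroup E] [NormedSpace ℝ E]

/-- Stochastic strict differentiability: uniformly over pairs of points in a small ball around
`x₀`, the increments of the random maps `A n ω` are, with probability tending to one, those of the
deterministic linear map `L` up to an arbitrarily small multiple of the distance. -/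
def HasAsymptoticStrictFDeriv (Pr : Measure Ω) (A : ℕ → Ω → V → E) (L : V →L[ℝ] E) (x₀ : V) :
    Prop :=
  ∀ η > 0, ∃ δ > 0, EventuallyLikely Pr fun n ω => ∀ x ∈ Metric.ball x₀ δ,
    ∀ y ∈ Metric.ball x₀ δ, ‖A n ω x - A n ω y - L (x - y)‖ ≤ η * ‖x - y‖

theorem norm_empiricalMean_sub_sub_le {α : Type*} (z : ℕ → α) (n : ℕ) {f g : α → E}
    {D : α → V →L[ℝ] E} {L : V →L[ℝ] E} {ρ : α → ℝ} {v : V} {c : ℝ}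
    (hfg : ∀ i, ‖f (z i) - g (z i) - D (z i) v‖ ≤ ρ (z i) * ‖v‖)
    (hc : empiricalMean z n ρ + ‖empiricalMean z n D - L‖ ≤ c) :
    ‖empiricalMean z n f - empiricalMean z n g - L v‖ ≤ c * ‖v‖ := by
  have happly : empiricalMean z n (fun a => D a v) = empiricalMean z n D v :=
    empiricalMean_clm_comp z n (ContinuousLinearMap.apply ℝ E v) D
  have hremainder := norm_empiricalMean_le (f := fun a => f a - g a - D a v)
    (g := fun a => ρ a * ‖v‖) hfg n
  rw [empiricalMean_mul_const, empiricalMean_sub, empiricalMean_sub, happly] at hremainder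
  have hderiv := (empiricalMean z n D - L).le_opNorm v
  calc ‖empiricalMean z n f - empiricalMean z n g - L v‖
      = ‖(empiricalMean z n f - empiricalMean z n g - empiricalMean z n D v)
          + (empiricalMean z n D - L) v‖ := by
        rw [sub_apply, sub_add_sub_cancel]
    _ ≤ empiricalMean z n ρ * ‖v‖ + ‖empiricalMean z n D - L‖ * ‖v‖ :=
        norm_add_le_of_le hremainder hderiv
    _ ≤ c * ‖v‖ := by
        rw [← add_mul]
        gcongr

theorem hasAsymptoticStrictFDeriv_empiricalMean {α : Type*} [MeasurableSpace α]
    [StandardBorelSpace α] {P : Measure α} {O : ℕ → Ω → α} [IsFiniteMeasure Pr] [IsFiniteMeasure P]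
    [FiniteDimensional ℝ V] [MeasurableSpace V] [BorelSpace V] [FiniteDimensional ℝ E]
    [MeasurableSpace E] [BorelSpace E] (hlaw : ∀ i, HasLaw (O i) P Pr)
    (hindep : Pairwise fun i j => IndepFun (O i) (O j) Pr) {f : α → V → E}
    (hf : Measurable fun z : α × V => f z.1 z.2) {x₀ : V} {N : Set V} (hN : N ∈ 𝓝 x₀)
    (hC1 : ∀ᵐ a ∂P, ContDiffOn ℝ 1 (f a) N) {G : α → ℝ} (hG : Integrable G P)
    (hle : ∀ᵐ a ∂P, ∀ x ∈ N, ‖fderiv ℝ (f a) x‖ ≤ G a) :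
    HasAsymptoticStrictFDeriv Pr (fun n ω x => empiricalMean (O · ω) n fun a => f a x)
      (∫ a, fderiv ℝ (f a) x₀ ∂P) x₀ := by
  have hfx : ∀ x, AEStronglyMeasurable (f · x) P := fun x => by
    have : ProperSpace E := FiniteDimensional.proper_real E
    exact (hf.comp (measurable_id.prodMk measurable_const)).aestronglyMeasurable
  have hint : Integrable (fun a => fderiv ℝ (f a) x₀) P := integrable_fderiv hfx
    (hC1.mono fun a ha => (ha.contDiffAt hN).differentiableAt one_ne_zero) hG
    (hle.mono fun a ha => ha x₀ (mem_of_mem_nhds hN))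
  intro η hη
  have hη3 : 0 < η / 3 := by positivity
  obtain ⟨δ, hδ, ρ, hρ, hρη, hρle⟩ := exists_integrable_strict_fderiv_modulus hf hN hC1 hG hle hη3
  refine ⟨δ, hδ, ((eventuallyLikely_empiricalMean hlaw hindep hρ hη3).and
    (eventuallyLikely_empiricalMean hlaw hindep hint hη3)).mono (Eventually.of_forall fun n => ?_)⟩
  filter_upwards [ae_forall_sample hlaw hρle] with ω hω ⟨hmean, hderiv⟩ x hx y hy
  refine norm_empiricalMean_sub_sub_le (D := fun a => fderiv ℝ (f a) x₀) (O · ω) n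
    (fun i => hω i x hx y hy) ?_
  linarith [(abs_lt.1 hmean).2]

variable {A : ℕ → Ω → V → E} {L : V →L[ℝ] E} {x₀ : V} {xhat : ℕ → Ω → V}

theorem HasAsymptoticStrictFDeriv.tendstoInMeasure_zero (h : HasAsymptoticStrictFDeriv Pr A L x₀)
    (hA : TendstoInMeasure Pr (fun n ω => A n ω x₀) atTop fun _ => 0)
    (hx : TendstoInMeasure Pr xhat atTop fun _ => x₀) :
    TendstoInMeasure Pr (fun n ω => A n ω (xhat n ω)) atTop fun _ => 0 := by
  rw [tendstoInMeasure_const_iff_eventuallyLikely] at hA hx ⊢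
  intro ε hε
  obtain ⟨δ, hδ, hstrict⟩ := h 1 one_pos
  have hC : 0 < 1 + ‖L‖ := by positivity
  refine ((hstrict.and (hx (min δ (ε / 2 / (1 + ‖L‖))) (by positivity))).and
    (hA (ε / 2) (by positivity))).mono' fun n ω ⟨⟨hst, hclose⟩, hsmall⟩ => ?_
  obtain ⟨hcloseδ, hcloseε⟩ := lt_min_iff.1 hclose
  rw [lt_div_iff₀' hC] at hcloseε
  rw [sub_zero] at hsmall ⊢
  have hincr := hst _ (mem_ball_iff_norm.2 hcloseδ) x₀ (Metric.mem_ball_self hδ)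
  calc ‖A n ω (xhat n ω)‖
      = ‖A n ω (xhat n ω) - A n ω x₀ - L (xhat n ω - x₀) + L (xhat n ω - x₀) + A n ω x₀‖ := by
        congr 1; abel
    _ ≤ 1 * ‖xhat n ω - x₀‖ + ‖L‖ * ‖xhat n ω - x₀‖ + ‖A n ω x₀‖ :=
        norm_add₃_le.trans (by gcongr; exact L.le_opNorm _)
    _ < ε := by linarith

theorem tendstoInMeasure_sub_clm_apply {xhat : ℕ → Ω → V} {y : ℕ → Ω → E} (T : E →L[ℝ] V)
    (hx : TendstoInMeasure Pr xhat atTop fun _ => x₀)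
    (hy : TendstoInMeasure Pr y atTop fun _ => 0) :
    TendstoInMeasure Pr (fun n ω => xhat n ω - T (y n ω)) atTop fun _ => x₀ := by
  rw [tendstoInMeasure_const_iff_eventuallyLikely] at hx hy ⊢
  intro ε hε
  have hT : 0 < ‖T‖ + 1 := by positivity
  refine ((hx (ε / 2) (by positivity)).and (hy (ε / 2 / (‖T‖ + 1)) (by positivity))).mono'
    fun n ω ⟨hxn, hyn⟩ => ?_
  rw [sub_zero, lt_div_iff₀' hT, add_mul, one_mul] at hyn
  calc ‖xhat n ω - T (y n ω) - x₀‖ = ‖xhat n ω - x₀ - T (y n ω)‖ := by rw [sub_right_comm]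
    _ ≤ ‖xhat n ω - x₀‖ + ‖T‖ * ‖y n ω‖ := norm_sub_le_of_le le_rfl (T.le_opNorm _)
    _ < ε := by linarith [hxn, norm_nonneg (y n ω)]

/-- The Newton step at least halves `‖f x‖`. -/
theorem eq_zero_of_norm_le_newton_step {f : V → E} {x : V} {Linv : E →L[ℝ] V}
    (hinv : ∀ y, L (Linv y) = y) {η : ℝ} (hη₀ : 0 ≤ η) (hη : η * ‖Linv‖ ≤ 1 / 2)
    (hstrict : ‖f (x - Linv (f x)) - f x - L (x - Linv (f x) - x)‖
      ≤ η * ‖x - Linv (f x) - x‖)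
    (hmin : ‖f x‖ ≤ ‖f (x - Linv (f x))‖) : f x = 0 := by
  rw [sub_sub_cancel_left, map_neg, hinv, sub_neg_eq_add, sub_add_cancel, norm_neg] at hstrict
  have hhalf : η * ‖Linv (f x)‖ ≤ 1 / 2 * ‖f x‖ := by
    calc η * ‖Linv (f x)‖ ≤ η * (‖Linv‖ * ‖f x‖) := by gcongr; exact Linv.le_opNorm _
      _ = η * ‖Linv‖ * ‖f x‖ := by ring
      _ ≤ 1 / 2 * ‖f x‖ := by gcongr
  exact norm_le_zero_iff.1 (by linarith)

theorem HasAsymptoticStrictFDeriv.eventuallyLikely_eq_zero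
    (h : HasAsymptoticStrictFDeriv Pr A L x₀) {Linv : E →L[ℝ] V} (hinv : ∀ y, L (Linv y) = y)
    (hA : TendstoInMeasure Pr (fun n ω => A n ω x₀) atTop fun _ => 0)
    (hx : TendstoInMeasure Pr xhat atTop fun _ => x₀) {U : Set V} (hU : U ∈ 𝓝 x₀)
    (hmin : EventuallyLikely Pr fun n ω => xhat n ω - Linv (A n ω (xhat n ω)) ∈ U →
      ‖A n ω (xhat n ω)‖ ≤ ‖A n ω (xhat n ω - Linv (A n ω (xhat n ω)))‖) :
    EventuallyLikely Pr fun n ω => A n ω (xhat n ω) = 0 := by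
  have hη : 1 / (2 * (‖Linv‖ + 1)) * ‖Linv‖ ≤ 1 / 2 := by
    rw [div_mul_eq_mul_div, one_mul, div_le_div_iff₀ (by positivity) (by norm_num)]
    linarith
  obtain ⟨δ, hδ, hstrict⟩ := h (1 / (2 * (‖Linv‖ + 1))) (by positivity)
  obtain ⟨r, hr, hrU⟩ := Metric.mem_nhds_iff.1 hU
  have hstep := tendstoInMeasure_sub_clm_apply Linv hx (h.tendstoInMeasure_zero hA hx)
  rw [tendstoInMeasure_const_iff_eventuallyLikely] at hx hstep
  refine ((hstrict.and hmin).and ((hx δ hδ).and (hstep (min δ r) (by positivity)))).mono'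
    fun n ω ⟨⟨hst, hle⟩, hclose, hclose'⟩ => ?_
  obtain ⟨hcloseδ, hcloser⟩ := lt_min_iff.1 hclose'
  exact eq_zero_of_norm_le_newton_step hinv (by positivity) hη
    (hst _ (mem_ball_iff_norm.2 hcloseδ) _ (mem_ball_iff_norm.2 hclose))
    (hle (hrU (mem_ball_iff_norm.2 hcloser)))

end AsymptoticStrictFDeriv

section Linearization

theorem exists_forall_measure_lt_norm_le {Ω Ω' E : Type*} [MeasurableSpace Ω] {Pr : Measure Ω}
    [IsProbabilityMeasure Pr] [MeasurableSpace Ω'] {ν : Measure Ω'} [IsProbabilityMeasure ν]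
    [NormedAddCommGroup E] [MeasurableSpace E] [BorelSpace E] [CompleteSpace E]
    [SecondCountableTopology E] {X : ℕ → Ω → E} {Z : Ω' → E}
    (h : TendstoInDistribution X atTop Z (fun _ => Pr) ν) {ε : ENNReal} (hε : 0 < ε) :
    ∃ K > 0, ∀ n, Pr {ω | K < ‖X n ω‖} ≤ ε := by
  have htight := isTightMeasureSet_of_isCompact_closure h.tendsto.isCompact_insert_range.closure
  obtain ⟨K, hK, hKpos⟩ := ((tendsto_measure_norm_gt_of_isTightMeasureSet
    htight).eventually_lt_const hε |>.and (eventually_gt_atTop 0)).exists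
  refine ⟨K, hKpos, fun n => ?_⟩
  rw [← Set.preimage_ofPred_eq (p := fun x => K < ‖x‖),
    ← Measure.map_apply_of_aemeasurable (h.forall_aemeasurable n)
      (measurableSet_lt measurable_const measurable_norm)]
  exact (le_iSup₂ (f := fun (μ : Measure E) _ => μ {x | K < ‖x‖}) _
    ⟨_, Set.mem_insert_of_mem _ ⟨n, rfl⟩, rfl⟩).trans hK.le

variable {V E : Type*} [NormedAddCommGroup V] [NormedSpace ℝ V] [NormedAddCommGroup E]
  [NormedSpace ℝ E] {L : V →L[ℝ] E} {Linv : E →L[ℝ] V}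

theorem norm_add_leftInverse_le (hinv : ∀ x, Linv (L x) = x) {t : V} {a : E} {η C : ℝ}
    (hη : 0 ≤ η) (h : ‖a + L t‖ ≤ η * ‖t‖) (hC : ‖Linv‖ ≤ C) (hCη : C * η ≤ 1 / 2) :
    ‖t + Linv a‖ ≤ 2 * C ^ 2 * η * ‖a‖ := by
  have hC₀ : 0 ≤ C := (norm_nonneg _).trans hC
  have hremainder : ‖t + Linv a‖ ≤ C * (η * ‖t‖) := by
    rw [← hinv t, add_comm, ← map_add, hinv]
    exact (Linv.le_of_opNorm_le hC _).trans (by gcongr)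
  have ht : ‖t‖ ≤ 2 * C * ‖a‖ := by
    have htri : ‖t‖ ≤ ‖t + Linv a‖ + ‖Linv a‖ := by
      simpa using norm_sub_le (t + Linv a) (Linv a)
    have hhalf : C * (η * ‖t‖) ≤ 1 / 2 * ‖t‖ := by
      rw [← mul_assoc]
      gcongr
    linarith [Linv.le_of_opNorm_le hC a]
  calc ‖t + Linv a‖ ≤ C * (η * (2 * C * ‖a‖)) := hremainder.trans (by gcongr)
    _ = 2 * C ^ 2 * η * ‖a‖ := by ring

variable {Ω : Type*} [MeasurableSpace Ω] {Pr : Measure Ω} {A : ℕ → Ω → V → E} {x₀ : V}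
  {xhat : ℕ → Ω → V}

theorem HasAsymptoticStrictFDeriv.eventuallyLikely_norm_add_leftInverse_le
    (h : HasAsymptoticStrictFDeriv Pr A L x₀) (hinv : ∀ x, Linv (L x) = x)
    (hx : TendstoInMeasure Pr xhat atTop fun _ => x₀)
    (hzero : EventuallyLikely Pr fun n ω => A n ω (xhat n ω) = 0) {ε : ℝ} (hε : 0 < ε) :
    EventuallyLikely Pr fun n ω => ‖xhat n ω - x₀ + Linv (A n ω x₀)‖ ≤ ε * ‖A n ω x₀‖ := by
  set C : ℝ := ‖Linv‖ + 1
  have hC : 0 < C := by positivity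
  set η : ℝ := min (1 / (2 * C)) (ε / (2 * C ^ 2))
  have hη₀ : 0 < η := by positivity
  have hCη : C * η ≤ 1 / 2 := by
    calc C * η ≤ C * (1 / (2 * C)) := by gcongr; exact min_le_left _ _
      _ = 1 / 2 := by field_simp
  have hηε : 2 * C ^ 2 * η ≤ ε := by
    calc 2 * C ^ 2 * η ≤ 2 * C ^ 2 * (ε / (2 * C ^ 2)) := by gcongr; exact min_le_right _ _
      _ = ε := by field_simp
  obtain ⟨δ, hδ, hstrict⟩ := h η hη₀
  refine ((hstrict.and (tendstoInMeasure_const_iff_eventuallyLikely.1 hx δ hδ)).and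
    hzero).mono' fun n ω ⟨⟨hst, hclose⟩, hz⟩ => ?_
  have hremainder := hst _ (mem_ball_iff_norm.2 hclose) x₀ (Metric.mem_ball_self hδ)
  rw [hz, zero_sub, ← neg_add', norm_neg] at hremainder
  exact (norm_add_leftInverse_le hinv hη₀.le hremainder (lt_add_one _).le hCη).trans (by gcongr)

theorem HasAsymptoticStrictFDeriv.tendstoInMeasure_linearization [IsProbabilityMeasure Pr]
    {Ω' : Type*} [MeasurableSpace Ω'] {ν : Measure Ω'} [IsProbabilityMeasure ν] {Z : Ω' → E}
    [MeasurableSpace E] [BorelSpace E] [CompleteSpace E] [SecondCountableTopology E]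
    (h : HasAsymptoticStrictFDeriv Pr A L x₀) (hinv : ∀ x, Linv (L x) = x)
    (hx : TendstoInMeasure Pr xhat atTop fun _ => x₀)
    (hzero : EventuallyLikely Pr fun n ω => A n ω (xhat n ω) = 0)
    (hclt : TendstoInDistribution (fun (n : ℕ) ω => √n • A n ω x₀) atTop Z (fun _ => Pr) ν) :
    TendstoInMeasure Pr (fun (n : ℕ) ω => √n • (xhat n ω - x₀ + Linv (A n ω x₀))) atTop
      fun _ => 0 := by
  refine tendstoInMeasure_iff_norm.2 fun ε hε => ?_
  simp only [sub_zero]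
  refine ENNReal.tendsto_nhds_zero.2 fun τ hτ => ?_
  have hτ2 := ENNReal.half_pos hτ.ne'
  obtain ⟨K, hK, hbounded⟩ := exists_forall_measure_lt_norm_le hclt hτ2
  have hlin := h.eventuallyLikely_norm_add_leftInverse_le hinv hx hzero
    (show 0 < ε / (2 * K) by positivity)
  filter_upwards [hlin.eventually_lt_const hτ2] with n hn
  rw [← ENNReal.add_halves τ]
  refine (measure_mono fun ω hω => ?_).trans
    ((measure_union_le _ _).trans (add_le_add (hbounded n) hn.le))
  by_contra! hcon
  simp only [Set.mem_union, Set.mem_ofPred_eq, not_or, not_lt, norm_smul] at hω hcon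
  obtain ⟨hAK, hle⟩ := hcon
  have hlt : ‖√(n : ℝ)‖ * ‖xhat n ω - x₀ + Linv (A n ω x₀)‖ < ε :=
    calc ‖√(n : ℝ)‖ * ‖xhat n ω - x₀ + Linv (A n ω x₀)‖
        ≤ ‖√(n : ℝ)‖ * (ε / (2 * K) * ‖A n ω x₀‖) := by gcongr
      _ = ε / (2 * K) * (‖√(n : ℝ)‖ * ‖A n ω x₀‖) := by ring
      _ ≤ ε / (2 * K) * K := by gcongr
      _ = ε / 2 := by field_simp
      _ < ε := half_lt_self hε
  exact absurd hω hlt.not_ge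

end Linearization

/-! ### The stacked estimating equations -/

section Blocks

variable {p q : ℕ}

/-- `betaPart` as a continuous linear map. -/
noncomputable def betaCLM (p q : ℕ) : Theta p q →L[ℝ] Vec 2 :=
  LinearMap.toContinuousLinearMap
    { toFun := betaPart, map_add' := fun _ _ => rfl, map_smul' := fun _ _ => rfl }

/-- `gammaPart` as a continuous linear map. -/
noncomputable def gammaCLM (p q : ℕ) : Theta p q →L[ℝ] Vec p :=
  LinearMap.toContinuousLinearMap
    { toFun := gammaPart, map_add' := fun _ _ => rfl, map_smul' := fun _ _ => rfl }

/-- `xiPart` as a continuous linear map. -/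
noncomputable def xiCLM (p q : ℕ) : Theta p q →L[ℝ] Vec q :=
  LinearMap.toContinuousLinearMap
    { toFun := xiPart, map_add' := fun _ _ => rfl, map_smul' := fun _ _ => rfl }

/-- `stack` as a continuous linear map. -/
noncomputable def stackCLM (p q : ℕ) : Vec 2 × Vec p × Vec q →L[ℝ] Theta p q :=
  LinearMap.toContinuousLinearMap
    { toFun := fun x => stack x.1 x.2.1 x.2.2
      map_add' := fun x y => by ext (k | k | k) <;> rfl
      map_smul' := fun c x => by ext (k | k | k) <;> rfl }

theorem stack_parts (θ : Theta p q) : stack (betaPart θ) (gammaPart θ) (xiPart θ) = θ := by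
  ext (k | k | k) <;> rfl

theorem norm_stack_sq (β : Vec 2) (γ : Vec p) (ξ : Vec q) :
    ‖stack β γ ξ‖ ^ 2 = ‖β‖ ^ 2 + (‖γ‖ ^ 2 + ‖ξ‖ ^ 2) := by
  simp only [EuclideanSpace.real_norm_sq_eq, Fintype.sum_sum_type]
  rfl

theorem norm_betaPart_le (θ : Theta p q) : ‖betaPart θ‖ ≤ ‖θ‖ := by
  have h := norm_stack_sq (betaPart θ) (gammaPart θ) (xiPart θ)
  rw [stack_parts] at h
  refine (sq_le_sq₀ (norm_nonneg _) (norm_nonneg _)).1 (h ▸ ?_)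
  exact le_add_of_nonneg_right (by positivity)

theorem norm_stack_zero_zero (β : Vec 2) : ‖stack β (0 : Vec p) (0 : Vec q)‖ = ‖β‖ :=
  (sq_eq_sq₀ (norm_nonneg _) (norm_nonneg _)).1 (by simp [norm_stack_sq])

theorem stack_single_left (i : Fin 2) :
    stack (EuclideanSpace.single i 1) 0 0
      = (EuclideanSpace.single (Sum.inl i) 1 : Theta p q) := by
  ext (k | k | k) <;> simp [stack]

theorem stack_single_middle (i : Fin p) :
    stack 0 (EuclideanSpace.single i 1) 0
      = (EuclideanSpace.single (Sum.inr (Sum.inl i)) 1 : Theta p q) := by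
  ext (k | k | k) <;> simp [stack]

theorem stack_single_right (i : Fin q) :
    stack 0 0 (EuclideanSpace.single i 1)
      = (EuclideanSpace.single (Sum.inr (Sum.inr i)) 1 : Theta p q) := by
  ext (k | k | k) <;> simp [stack]

theorem hasFDerivAt_stack_left (β : Vec 2) (γ : Vec p) (ξ : Vec q) :
    HasFDerivAt (fun b => stack b γ ξ)
      ((stackCLM p q).comp (ContinuousLinearMap.inl ℝ (Vec 2) (Vec p × Vec q))) β :=
  (stackCLM p q).hasFDerivAt.comp β (hasFDerivAt_prodMk_left β (γ, ξ))

theorem hasFDerivAt_stack_middle (β : Vec 2) (γ : Vec p) (ξ : Vec q) :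
    HasFDerivAt (fun g => stack β g ξ)
      ((stackCLM p q).comp ((ContinuousLinearMap.inr ℝ (Vec 2) (Vec p × Vec q)).comp
        (ContinuousLinearMap.inl ℝ (Vec p) (Vec q)))) γ :=
  (stackCLM p q).hasFDerivAt.comp γ
    (HasFDerivAt.comp (f := (·, ξ)) γ (hasFDerivAt_prodMk_right β (γ, ξ))
      (hasFDerivAt_prodMk_left γ ξ))

theorem hasFDerivAt_stack_right (β : Vec 2) (γ : Vec p) (ξ : Vec q) :
    HasFDerivAt (fun x => stack β γ x)
      ((stackCLM p q).comp ((ContinuousLinearMap.inr ℝ (Vec 2) (Vec p × Vec q)).comp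
        (ContinuousLinearMap.inr ℝ (Vec p) (Vec q)))) ξ :=
  (stackCLM p q).hasFDerivAt.comp ξ
    (HasFDerivAt.comp (f := (γ, ·)) ξ (hasFDerivAt_prodMk_right β (γ, ξ))
      (hasFDerivAt_prodMk_right γ ξ))

theorem tendstoInMeasure_stack {Ω : Type*} [MeasurableSpace Ω] {Pr : Measure Ω}
    {βhat : ℕ → Ω → Vec 2} {γhat : ℕ → Ω → Vec p} {ξhat : ℕ → Ω → Vec q}
    {β : Vec 2} {γ : Vec p} {ξ : Vec q}
    (hβ : TendstoInMeasure Pr βhat atTop fun _ => β)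
    (hγ : TendstoInMeasure Pr γhat atTop fun _ => γ)
    (hξ : TendstoInMeasure Pr ξhat atTop fun _ => ξ) :
    TendstoInMeasure Pr (fun n ω => stack (βhat n ω) (γhat n ω) (ξhat n ω)) atTop
      fun _ => stack β γ ξ := by
  simp only [tendstoInMeasure_const_iff_eventuallyLikely] at hβ hγ hξ ⊢
  intro ε hε
  obtain ⟨δ, hδ, hball⟩ := Metric.continuous_iff.1 (stackCLM p q).continuous (β, γ, ξ) ε hε
  refine ((hβ δ hδ).and ((hγ δ hδ).and (hξ δ hδ))).mono' fun n ω ⟨h₁, h₂, h₃⟩ => ?_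
  have h := hball (βhat n ω, γhat n ω, ξhat n ω) (by
    rw [dist_eq_norm, Prod.mk_sub_mk, Prod.mk_sub_mk]
    exact max_lt h₁ (max_lt h₂ h₃))
  rwa [dist_eq_norm] at h

end Blocks

section Jacobian

variable {ι κ ι' κ' : Type*} [Fintype ι] [DecidableEq ι] [Fintype κ] [Fintype ι']
  [DecidableEq ι'] [Fintype κ']

theorem jacobian_const (c : EuclideanSpace ℝ κ) (x : EuclideanSpace ℝ ι) :
    jacobian (fun _ => c) x = 0 := by
  ext k i
  simp [jacobian]

theorem jacobian_comp_apply {f : EuclideanSpace ℝ ι → EuclideanSpace ℝ κ}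
    {r : EuclideanSpace ℝ κ →L[ℝ] EuclideanSpace ℝ κ'}
    {e : EuclideanSpace ℝ ι' → EuclideanSpace ℝ ι}
    {e' : EuclideanSpace ℝ ι' →L[ℝ] EuclideanSpace ℝ ι} {x : EuclideanSpace ℝ ι'}
    (he : HasFDerivAt e e' x) (hf : DifferentiableAt ℝ f (e x)) {i : ι'} {j : ι} {k : κ'} {l : κ}
    (hi : e' (EuclideanSpace.single i 1) = EuclideanSpace.single j 1) (hk : ∀ v, r v k = v l) :
    jacobian (fun y => r (f (e y))) x k i = jacobian f (e x) l j := by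
  have h : HasFDerivAt (fun y => r (f (e y))) (r.comp ((fderiv ℝ f (e x)).comp e')) x :=
    r.hasFDerivAt.comp x (hf.hasFDerivAt.comp x he)
  simp [jacobian, h.fderiv, hi, hk]

theorem toEuclideanCLM_expJacobian {d : ℕ} {P : Measure (Obs d)}
    {F : Obs d → EuclideanSpace ℝ ι → EuclideanSpace ℝ ι} {θ : EuclideanSpace ℝ ι}
    (hF : Integrable (fun o => fderiv ℝ (F o) θ) P) :
    Matrix.toEuclideanCLM (𝕜 := ℝ) (expJacobian P F θ) = ∫ o, fderiv ℝ (F o) θ ∂P := by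
  refine ContinuousLinearMap.coe_injective
    ((EuclideanSpace.basisFun ι ℝ).toBasis.ext fun i => ?_)
  ext k
  have hproj := (EuclideanSpace.proj k : EuclideanSpace ℝ ι →L[ℝ] ℝ).integral_comp_comm
    (hF.apply_continuousLinearMap (EuclideanSpace.single i 1))
  rw [← ContinuousLinearMap.integral_apply hF] at hproj
  simpa [expJacobian, jacobian, Matrix.ofLp_toEuclideanCLM] using hproj

end Jacobian

section PhiTilde

variable {d p q : ℕ} {M : Ingredients d p q} {P : Measure (Obs d)} {β₀ : Vec 2}
  {γs : Vec p} {ξs : Vec q}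

theorem measurable_phiTilde :
    Measurable fun x : Obs d × Theta p q => phiTilde M P β₀ x.1 x.2 := by
  have hβ : Measurable (betaPart : Theta p q → Vec 2) := (betaCLM p q).measurable
  have hγ : Measurable (gammaPart : Theta p q → Vec p) := (gammaCLM p q).measurable
  have hξ : Measurable (xiPart : Theta p q → Vec q) := (xiCLM p q).measurable
  have hphi : Measurable fun x : Obs d × Theta p q =>
      phi M P β₀ x.1 (betaPart x.2) (gammaPart x.2) (xiPart x.2) :=
    (measurable_phi M P β₀).comp (f := fun x : Obs d × Theta p q =>
      (x.1, betaPart x.2, gammaPart x.2, xiPart x.2)) (by fun_prop)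
  have hmγ : Measurable fun x : Obs d × Theta p q => obsMGamma M x.1 (gammaPart x.2) :=
    M.measurable_mGamma.comp (f := fun x : Obs d × Theta p q => (x.1.2.2, z1 x.1, gammaPart x.2))
      (by fun_prop)
  have hmξ : Measurable fun x : Obs d × Theta p q => M.mXi (z1 x.1) (z2 x.1) (xiPart x.2) :=
    M.measurable_mXi.comp (f := fun x : Obs d × Theta p q => (z1 x.1, z2 x.1, xiPart x.2))
      (by fun_prop)
  have hRmξ : Measurable fun x : Obs d × Theta p q => obsMXi M x.1 (xiPart x.2) :=
    (measurable_rInd.comp measurable_fst).smul hmξ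
  exact (stackCLM p q).measurable.comp (hphi.prodMk (hmγ.prodMk hRmξ))

theorem jacobian_phiTilde_eq_fromBlocks {o : Obs d}
    (h : DifferentiableAt ℝ (phiTilde M P β₀ o) (stack β₀ γs ξs)) :
    jacobian (phiTilde M P β₀ o) (stack β₀ γs ξs) = Matrix.fromBlocks
      (jacobian (fun β => phi M P β₀ o β γs ξs) β₀)
      (Matrix.fromCols (jacobian (fun γ => phi M P β₀ o β₀ γ ξs) γs)
        (jacobian (fun ξ => phi M P β₀ o β₀ γs ξ) ξs)) 0
      (Matrix.fromBlocks (jacobian (obsMGamma M o) γs) 0 0 (jacobian (obsMXi M o) ξs)) := by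
  have hl := hasFDerivAt_stack_left β₀ γs ξs
  have hm := hasFDerivAt_stack_middle β₀ γs ξs
  have hr := hasFDerivAt_stack_right β₀ γs ξs
  have hβ (k : Fin 2) (v : Theta p q) : betaCLM p q v k = v (Sum.inl k) := rfl
  have hγ (k : Fin p) (v : Theta p q) : gammaCLM p q v k = v (Sum.inr (Sum.inl k)) := rfl
  have hξ (k : Fin q) (v : Theta p q) : xiCLM p q v k = v (Sum.inr (Sum.inr k)) := rfl
  ext (k | k | k) (i | i | i)
  · exact (jacobian_comp_apply hl h (stack_single_left i) (hβ k)).symm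
  · exact (jacobian_comp_apply hm h (stack_single_middle i) (hβ k)).symm
  · exact (jacobian_comp_apply hr h (stack_single_right i) (hβ k)).symm
  · exact (jacobian_comp_apply hl h (stack_single_left i) (hγ k)).symm.trans
      (congrFun₂ (jacobian_const (obsMGamma M o γs) β₀) k i)
  · exact (jacobian_comp_apply hm h (stack_single_middle i) (hγ k)).symm
  · exact (jacobian_comp_apply hr h (stack_single_right i) (hγ k)).symm.trans
      (congrFun₂ (jacobian_const (obsMGamma M o γs) ξs) k i)
  · exact (jacobian_comp_apply hl h (stack_single_left i) (hξ k)).symm.trans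
      (congrFun₂ (jacobian_const (obsMXi M o ξs) β₀) k i)
  · exact (jacobian_comp_apply hm h (stack_single_middle i) (hξ k)).symm.trans
      (congrFun₂ (jacobian_const (obsMXi M o ξs) γs) k i)
  · exact (jacobian_comp_apply hr h (stack_single_right i) (hξ k)).symm

theorem expJacobian_phiTilde_eq_fromBlocks
    (h : ∀ᵐ o ∂P, DifferentiableAt ℝ (phiTilde M P β₀ o) (stack β₀ γs ξs)) :
    expJacobian P (phiTilde M P β₀) (stack β₀ γs ξs) = Matrix.fromBlocks
      (expJacobian P (fun o β => phi M P β₀ o β γs ξs) β₀)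
      (Matrix.fromCols (expJacobian P (fun o γ => phi M P β₀ o β₀ γ ξs) γs)
        (expJacobian P (fun o ξ => phi M P β₀ o β₀ γs ξ) ξs)) 0
      (Matrix.fromBlocks (expJacobian P (obsMGamma M) γs) 0 0 (expJacobian P (obsMXi M) ξs)) := by
  ext k i
  have hae := integral_congr_ae
    (h.mono fun o ho => congrFun₂ (jacobian_phiTilde_eq_fromBlocks ho) k i)
  refine hae.trans ?_
  rcases k with k | k | k <;> rcases i with i | i | i <;>
    first | rfl | exact integral_zero _ _

theorem empiricalMean_phiTilde (o : ℕ → Obs d) (n : ℕ) (θ : Theta p q) :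
    empiricalMean o n (fun a => phiTilde M P β₀ a θ)
      = stack (empiricalMean o n fun a => phi M P β₀ a (betaPart θ) (gammaPart θ) (xiPart θ))
        (empiricalMean o n fun a => obsMGamma M a (gammaPart θ))
        (empiricalMean o n fun a => obsMXi M a (xiPart θ)) := by
  have hβ := empiricalMean_clm_comp o n (betaCLM p q) fun a => phiTilde M P β₀ a θ
  have hγ := empiricalMean_clm_comp o n (gammaCLM p q) fun a => phiTilde M P β₀ a θ
  have hξ := empiricalMean_clm_comp o n (xiCLM p q) fun a => phiTilde M P β₀ a θ
  refine (stack_parts _).symm.trans ?_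
  exact congr (congrArg₂ stack hβ.symm hγ.symm) hξ.symm

end PhiTilde

section ExpectedJacobian

variable {d p q : ℕ} {M : Ingredients d p q} {P : Measure (Obs d)} {β₀ : Vec 2}
  {γs : Vec p} {ξs : Vec q} {B : Set (Vec 2)}

/-- The difference quotients of `φ` in `β` are the augmented inverse probability weightings of those
of `m_ψ`, so double robustness passes to the limit. -/
theorem integral_fderiv_phi_eq [IsFiniteMeasure P] (hMAR : MissingAtRandom P)
    (hcorrect : PropensityCorrect M P γs ∨ OutcomeCorrect M P β₀ B ξs) {β : Vec 2}
    (hB : B ∈ 𝓝 β) {G : Obs d → ℝ} (hG : Integrable G P) {S : Set (Vec 2)} (hS : S ∈ 𝓝 β)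
    (hlip : ∀ᵐ o ∂P, ∀ b ∈ S, ‖phi M P β₀ o b γs ξs - phi M P β₀ o β γs ξs‖ ≤ G o * ‖b - β‖)
    (hphi : ∀ᵐ o ∂P, DifferentiableAt ℝ (fun b => phi M P β₀ o b γs ξs) β)
    (hm : ∀ᵐ o ∂P, DifferentiableAt ℝ (mPsi M P β₀ o) β) {v : Vec 2}
    (hmi : Integrable (fun o => fderiv ℝ (mPsi M P β₀ o) β v) P) :
    ∫ o, fderiv ℝ (fun b => phi M P β₀ o b γs ξs) β v ∂P
      = ∫ o, fderiv ℝ (mPsi M P β₀ o) β v ∂P := by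
  obtain ⟨π₀, H, hπ₀⟩ := hMAR.exists_hasPropensity
  have hline : Tendsto (fun t : ℝ => β + t • v) (𝓝[≠] 0) (𝓝 β) :=
    tendsto_nhdsWithin_of_tendsto_nhds (Continuous.tendsto' (by fun_prop) _ _ (by simp))
  obtain ⟨t, ht, htmem⟩ := exists_seq_forall_of_frequently
    (((hline.eventually_mem hS).and ((hline.eventually_mem hB).and
      (eventually_mem_nhdsWithin (a := (0 : ℝ)) (s := {0}ᶜ)))).frequently)
  have hquot {f : Vec 2 → Vec 2} (hf : DifferentiableAt ℝ f β) :
      Tendsto (fun n => (t n)⁻¹ • (f (β + t n • v) - f β)) atTop (𝓝 (fderiv ℝ f β v)) :=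
    (hf.hasFDerivAt.hasLineDerivAt v).tendsto_slope_zero.comp ht
  have haipw (n : ℕ) (o : Obs d) :
      aipw rInd (fun o => M.prop (z1 o) γs)
        ((t n)⁻¹ • ((mPsi M P β₀ · (β + t n • v)) - (mPsi M P β₀ · β)))
        ((t n)⁻¹ • ((fun o => M.h (z1 o) (β + t n • v) ξs) - fun o => M.h (z1 o) β ξs)) o
      = (t n)⁻¹ • (phi M P β₀ o (β + t n • v) γs ξs - phi M P β₀ o β γs ξs) := by
    rw [aipw_const_smul_sub]
    rfl
  refine integral_eq_of_tendsto_aipw H hπ₀ (stronglyMeasurable_prop_sigmaZ1 M γs)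
    (fun o => M.prop_pos (z1 o) γs)
    (fun n => ((stronglyMeasurable_mPsi_sigmaZ M P β₀ (β + t n • v)).sub
      (stronglyMeasurable_mPsi_sigmaZ M P β₀ β)).const_smul (t n)⁻¹)
    (fun n => ((stronglyMeasurable_h_sigmaZ1 M (β + t n • v) ξs).sub
      (stronglyMeasurable_h_sigmaZ1 M β ξs)).const_smul (t n)⁻¹)
    (hcorrect.imp (fun h => h.symm.trans H.condExp) fun h n =>
      h.const_smul_sub (htmem n).2.1 (mem_of_mem_nhds hB) _)
    (hG.mul_const ‖v‖) (fun n => ?_) hmi (hm.mono fun o ho => hquot ho) ?_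
  · filter_upwards [hlip] with o ho
    have hlipn := ho _ (htmem n).1
    rw [add_sub_cancel_left, norm_smul] at hlipn
    rw [haipw, norm_smul, norm_inv, inv_mul_le_iff₀ (norm_pos_iff.2 (htmem n).2.2)]
    linarith
  · filter_upwards [hphi] with o ho
    simpa only [haipw] using hquot ho

theorem hasFDerivAt_phi_of_phiTilde {o : Obs d} {D : Theta p q →L[ℝ] Theta p q}
    (h : HasFDerivAt (phiTilde M P β₀ o) D (stack β₀ γs ξs)) :
    HasFDerivAt (fun β => phi M P β₀ o β γs ξs) ((betaCLM p q).comp (D.comp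
      ((stackCLM p q).comp (ContinuousLinearMap.inl ℝ (Vec 2) (Vec p × Vec q))))) β₀ :=
  (betaCLM p q).hasFDerivAt.comp β₀
    (HasFDerivAt.comp (g := phiTilde M P β₀ o) β₀ h (hasFDerivAt_stack_left β₀ γs ξs))

namespace NormalityConditions

theorem ae_differentiableAt (hN : NormalityConditions M P β₀ γs ξs B) :
    ∀ᵐ o ∂P, DifferentiableAt ℝ (phiTilde M P β₀ o) (stack β₀ γs ξs) := by
  obtain ⟨N, hNo, hmem, hC1, -⟩ := hN.smooth
  filter_upwards [hC1] with o ho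
  exact (ho.contDiffAt (hNo.mem_nhds hmem)).differentiableAt one_ne_zero

theorem integrable_fderiv_phiTilde (hN : NormalityConditions M P β₀ γs ξs B) :
    Integrable (fun o => fderiv ℝ (phiTilde M P β₀ o) (stack β₀ γs ξs)) P := by
  obtain ⟨N, -, hmem, -, G, hG, hle⟩ := hN.smooth
  exact integrable_fderiv
    (fun θ => (measurable_phiTilde.comp measurable_prodMk_right).aestronglyMeasurable)
    hN.ae_differentiableAt hG (hle.mono fun o ho => ho _ hmem)

theorem integrable_fderiv_phi (hN : NormalityConditions M P β₀ γs ξs B) :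
    Integrable (fun o => fderiv ℝ (fun β => phi M P β₀ o β γs ξs) β₀) P := by
  refine (((ContinuousLinearMap.compL ℝ _ _ _ (betaCLM p q)).integrable_comp
    (((ContinuousLinearMap.compL ℝ _ _ _).flip ((stackCLM p q).comp
      (ContinuousLinearMap.inl ℝ (Vec 2) (Vec p × Vec q)))).integrable_comp
        hN.integrable_fderiv_phiTilde))).congr ?_
  filter_upwards [hN.ae_differentiableAt] with o ho
  exact (hasFDerivAt_phi_of_phiTilde ho.hasFDerivAt).fderiv.symm

theorem mem_nhds (hN : NormalityConditions M P β₀ γs ξs B) : B ∈ 𝓝 β₀ :=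
  (hasFDerivAt_stack_left β₀ γs ξs).continuousAt.preimage_mem_nhds
    (mem_interior_iff_mem_nhds.1 hN.interior_mem)

theorem exists_integrable_lipschitz_phi (hN : NormalityConditions M P β₀ γs ξs B) :
    ∃ G : Obs d → ℝ, Integrable G P ∧ ∃ S ∈ 𝓝 β₀, ∀ᵐ o ∂P, ∀ β ∈ S,
      ‖phi M P β₀ o β γs ξs - phi M P β₀ o β₀ γs ξs‖ ≤ G o * ‖β - β₀‖ := by
  obtain ⟨N, hNo, hmem, hC1, G, hG, hle⟩ := hN.smooth
  obtain ⟨r, hr, hrN⟩ := Metric.isOpen_iff.1 hNo _ hmem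
  have hdiff (β : Vec 2) :
      stack β γs ξs - stack β₀ γs ξs = stack (β - β₀) (0 : Vec p) (0 : Vec q) := by
    ext (k | k | k) <;> simp [stack]
  refine ⟨G, hG, Metric.ball β₀ r, Metric.ball_mem_nhds _ hr, ?_⟩
  filter_upwards [hC1, hle] with o hC1o hleo β hβ
  have hball : stack β γs ξs ∈ Metric.ball (stack β₀ γs ξs) r := by
    rwa [mem_ball_iff_norm, hdiff, norm_stack_zero_zero, ← mem_ball_iff_norm]
  have hmean := (convex_ball (stack β₀ γs ξs) r).norm_image_sub_le_of_norm_fderiv_le (𝕜 := ℝ)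
    (f := phiTilde M P β₀ o)
    (fun θ hθ => (hC1o.contDiffAt (hNo.mem_nhds (hrN hθ))).differentiableAt one_ne_zero)
    (fun θ hθ => hleo θ (hrN hθ)) (Metric.mem_ball_self hr) hball
  rw [hdiff, norm_stack_zero_zero] at hmean
  exact (norm_betaPart_le
    (phiTilde M P β₀ o (stack β γs ξs) - phiTilde M P β₀ o (stack β₀ γs ξs))).trans hmean

theorem expJacobian_phi_eq [IsFiniteMeasure P] (hN : NormalityConditions M P β₀ γs ξs B)
    (hMAR : MissingAtRandom P)
    (hcorrect : PropensityCorrect M P γs ∨ OutcomeCorrect M P β₀ B ξs) :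
    expJacobian P (fun o β => phi M P β₀ o β γs ξs) β₀ = expJacobian P (mPsi M P β₀) β₀ := by
  obtain ⟨G, hG, S, hS, hlip⟩ := hN.exists_integrable_lipschitz_phi
  ext k i
  have hphi := hN.integrable_fderiv_phi.apply_continuousLinearMap (EuclideanSpace.single i 1)
  have hm : Integrable (fun o => fderiv ℝ (mPsi M P β₀ o) β₀ (EuclideanSpace.single i 1)) P :=
    Integrable.of_eval_piLp fun k => hN.integrable_mPsi k i
  have hdiff : ∀ᵐ o ∂P, DifferentiableAt ℝ (fun β => phi M P β₀ o β γs ξs) β₀ :=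
    hN.ae_differentiableAt.mono fun o ho =>
      (hasFDerivAt_phi_of_phiTilde ho.hasFDerivAt).differentiableAt
  change ∫ o, fderiv ℝ (fun β => phi M P β₀ o β γs ξs) β₀ (EuclideanSpace.single i 1) k ∂P
    = ∫ o, fderiv ℝ (mPsi M P β₀ o) β₀ (EuclideanSpace.single i 1) k ∂P
  rw [← eval_integral_piLp fun k => hphi.eval_piLp k, ← eval_integral_piLp fun k => hm.eval_piLp k,
    integral_fderiv_phi_eq hMAR hcorrect hN.mem_nhds hG hS hlip hdiff hN.differentiable_mPsi hm]

end NormalityConditions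

end ExpectedJacobian

/-! ### Asymptotic normality -/

section InverseMatrix

variable {ι : Type*} [Fintype ι] [DecidableEq ι] {A : Matrix ι ι ℝ}

theorem toEuclideanCLM_nonsing_inv_apply (hA : IsUnit A.det) (x : EuclideanSpace ℝ ι) :
    Matrix.toEuclideanCLM (𝕜 := ℝ) A⁻¹ (Matrix.toEuclideanCLM (𝕜 := ℝ) A x) = x := by
  rw [← mul_apply_eq_comp, ← map_mul, Matrix.nonsing_inv_mul _ hA, map_one, one_apply_eq_self]

theorem toEuclideanCLM_apply_nonsing_inv (hA : IsUnit A.det) (x : EuclideanSpace ℝ ι) :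
    Matrix.toEuclideanCLM (𝕜 := ℝ) A (Matrix.toEuclideanCLM (𝕜 := ℝ) A⁻¹ x) = x := by
  rw [← mul_apply_eq_comp, ← map_mul, Matrix.mul_nonsing_inv _ hA, map_one, one_apply_eq_self]

end InverseMatrix

section AsymptoticNormality

variable {d p q : ℕ} {M : Ingredients d p q} {P : Measure (Obs d)} {β₀ : Vec 2}
  {γs : Vec p} {ξs : Vec q} {B : Set (Vec 2)}

/-- The inverse of `E ∇φ̃(θ₀)` as an operator: a Newton step for the stacked estimating equations
subtracts its value at the empirical mean of `φ̃`. -/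
noncomputable def invExpJacobian (M : Ingredients d p q) (P : Measure (Obs d)) (β₀ : Vec 2)
    (γs : Vec p) (ξs : Vec q) : Theta p q →L[ℝ] Theta p q :=
  Matrix.toEuclideanCLM (𝕜 := ℝ) (expJacobian P (phiTilde M P β₀) (stack β₀ γs ξs))⁻¹

namespace NormalityConditions

theorem isUnit_expJacobian (hN : NormalityConditions M P β₀ γs ξs B) :
    IsUnit (expJacobian P (phiTilde M P β₀) (stack β₀ γs ξs)).det := by
  have h := (Matrix.isUnit_iff_isUnit_det _).1 hN.nonsingular
  rw [Matrix.det_mul] at h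
  exact isUnit_of_mul_isUnit_right h

theorem isUnit_blocks [IsFiniteMeasure P] (hN : NormalityConditions M P β₀ γs ξs B)
    (hMAR : MissingAtRandom P)
    (hcorrect : PropensityCorrect M P γs ∨ OutcomeCorrect M P β₀ B ξs) :
    IsUnit (expJacobian P (mPsi M P β₀) β₀).det ∧ IsUnit (expJacobian P (obsMGamma M) γs).det ∧
      IsUnit (expJacobian P (obsMXi M) ξs).det := by
  have h := hN.isUnit_expJacobian
  rw [expJacobian_phiTilde_eq_fromBlocks hN.ae_differentiableAt, Matrix.det_fromBlocks_zero₂₁,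
    Matrix.det_fromBlocks_zero₂₁, hN.expJacobian_phi_eq hMAR hcorrect] at h
  exact ⟨isUnit_of_mul_isUnit_left h, isUnit_of_mul_isUnit_left (isUnit_of_mul_isUnit_right h),
    isUnit_of_mul_isUnit_right (isUnit_of_mul_isUnit_right h)⟩

theorem invExpJacobian_stack [IsFiniteMeasure P] (hN : NormalityConditions M P β₀ γs ξs B)
    (hMAR : MissingAtRandom P)
    (hcorrect : PropensityCorrect M P γs ∨ OutcomeCorrect M P β₀ B ξs)
    (u : Vec 2) (v : Vec p) (w : Vec q) :
    invExpJacobian M P β₀ γs ξs (stack u v w) =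
      stack (WithLp.toLp 2 ((expJacobian P (mPsi M P β₀) β₀)⁻¹.mulVec (u.ofLp
        - (expJacobian P (fun o γ => phi M P β₀ o β₀ γ ξs) γs).mulVec
            ((expJacobian P (obsMGamma M) γs)⁻¹.mulVec v.ofLp)
        - (expJacobian P (fun o ξ => phi M P β₀ o β₀ γs ξ) ξs).mulVec
            ((expJacobian P (obsMXi M) ξs)⁻¹.mulVec w.ofLp))))
        (WithLp.toLp 2 ((expJacobian P (obsMGamma M) γs)⁻¹.mulVec v.ofLp))
        (WithLp.toLp 2 ((expJacobian P (obsMXi M) ξs)⁻¹.mulVec w.ofLp)) := by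
  obtain ⟨hβ, hγ, hξ⟩ := hN.isUnit_blocks hMAR hcorrect
  have hJ := hN.isUnit_expJacobian
  refine WithLp.ofLp_injective 2
    (Matrix.mulVec_injective_of_isUnit ((Matrix.isUnit_iff_isUnit_det _).2 hJ) ?_)
  rw [invExpJacobian, Matrix.ofLp_toEuclideanCLM, Matrix.mulVec_mulVec,
    Matrix.mul_nonsing_inv _ hJ, Matrix.one_mulVec,
    expJacobian_phiTilde_eq_fromBlocks hN.ae_differentiableAt, hN.expJacobian_phi_eq hMAR hcorrect]
  simp only [stack, Matrix.fromBlocks_mulVec, Matrix.fromCols_mulVec, Sum.elim_comp_inl,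
    Sum.elim_comp_inr, Matrix.mulVec_mulVec, Matrix.zero_mul, Matrix.zero_mulVec, zero_add,
    add_zero, Matrix.mul_nonsing_inv _ hβ, Matrix.mul_nonsing_inv _ hγ, Matrix.mul_nonsing_inv _ hξ,
    Matrix.one_mulVec]
  congr 1
  abel

theorem influence_eq [IsFiniteMeasure P] (hN : NormalityConditions M P β₀ γs ξs B)
    (hMAR : MissingAtRandom P)
    (hcorrect : PropensityCorrect M P γs ∨ OutcomeCorrect M P β₀ B ξs) (o : Obs d) :
    influence M P β₀ γs ξs o
      = -betaPart (invExpJacobian M P β₀ γs ξs (phiTilde M P β₀ o (stack β₀ γs ξs))) := by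
  rw [phiTilde, hN.invExpJacobian_stack hMAR hcorrect]
  rfl

/-- At a zero of the nuisance equations the Newton step moves `β` only, so it stays among the
competitors of the minimizer. -/
theorem norm_empiricalMean_phiTilde_le_newtonStep [IsFiniteMeasure P]
    (hN : NormalityConditions M P β₀ γs ξs B) (hMAR : MissingAtRandom P)
    (hcorrect : PropensityCorrect M P γs ∨ OutcomeCorrect M P β₀ B ξs)
    {n : ℕ} {o : ℕ → Obs d} {β : Vec 2} {γ : Vec p} {ξ : Vec q} {A : Theta p q → Theta p q}
    (hA : A = fun θ => empiricalMean o n fun a => phiTilde M P β₀ a θ)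
    (hγ : empiricalMean o n (obsMGamma M · γ) = 0) (hξ : empiricalMean o n (obsMXi M · ξ) = 0)
    (hmin : ∀ b ∈ B, Qhat M P β₀ n o β γ ξ ≤ Qhat M P β₀ n o b γ ξ)
    (hB : betaPart (stack β γ ξ - invExpJacobian M P β₀ γs ξs (A (stack β γ ξ))) ∈ B) :
    ‖A (stack β γ ξ)‖
      ≤ ‖A (stack β γ ξ - invExpJacobian M P β₀ γs ξs (A (stack β γ ξ)))‖ := by
  subst hA
  have hmean : (empiricalMean o n fun a => phiTilde M P β₀ a (stack β γ ξ))
      = stack (empiricalMean o n fun a => phi M P β₀ a β γ ξ) 0 0 := by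
    rw [← hγ, ← hξ]
    exact empiricalMean_phiTilde o n (stack β γ ξ)
  obtain ⟨c, hc⟩ : ∃ c, invExpJacobian M P β₀ γs ξs
      (stack (empiricalMean o n fun a => phi M P β₀ a β γ ξ) 0 0) = stack c 0 0 := by
    rw [hN.invExpJacobian_stack hMAR hcorrect]
    simp only [WithLp.ofLp_zero, Matrix.mulVec_zero, WithLp.toLp_zero]
    exact ⟨_, rfl⟩
  have hb : stack β γ ξ - invExpJacobian M P β₀ γs ξs
      (empiricalMean o n fun a => phiTilde M P β₀ a (stack β γ ξ)) = stack (β - c) γ ξ := by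
    rw [hmean, hc]
    ext (k | k | k) <;> simp [stack]
  simp only [hb] at hB ⊢
  rw [hmean, norm_stack_zero_zero]
  refine (norm_empiricalMean_le_of_Qhat_le (hmin _ hB)).trans ?_
  exact (norm_betaPart_le _).trans' (by rw [empiricalMean_phiTilde]; exact le_rfl)

variable {Ω : Type*} [MeasurableSpace Ω] {Pr : Measure Ω} {O : ℕ → Ω → Obs d}
  {γhat : ℕ → Ω → Vec p} {ξhat : ℕ → Ω → Vec q} {βhat : ℕ → Ω → Vec 2}

theorem hasAsymptoticStrictFDeriv [IsFiniteMeasure Pr] [IsFiniteMeasure P]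
    (hN : NormalityConditions M P β₀ γs ξs B) (hlaw : ∀ i, HasLaw (O i) P Pr)
    (hindep : Pairwise fun i j => IndepFun (O i) (O j) Pr) :
    HasAsymptoticStrictFDeriv Pr
      (fun n ω θ => empiricalMean (O · ω) n fun a => phiTilde M P β₀ a θ)
      (Matrix.toEuclideanCLM (𝕜 := ℝ) (expJacobian P (phiTilde M P β₀) (stack β₀ γs ξs)))
      (stack β₀ γs ξs) := by
  obtain ⟨N, hNo, hmem, hC1, G, hG, hle⟩ := hN.smooth
  rw [toEuclideanCLM_expJacobian hN.integrable_fderiv_phiTilde]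
  exact hasAsymptoticStrictFDeriv_empiricalMean hlaw hindep measurable_phiTilde
    (hNo.mem_nhds hmem) hC1 hG hle

theorem eventuallyLikely_empiricalMean_eq_zero [IsProbabilityMeasure Pr] [IsFiniteMeasure P]
    (hN : NormalityConditions M P β₀ γs ξs B) (hlaw : ∀ i, HasLaw (O i) P Pr)
    (hindep : Pairwise fun i j => IndepFun (O i) (O j) Pr) (hMAR : MissingAtRandom P)
    (hβhat : EventuallyLikely Pr fun n ω => βhat n ω ∈ B ∧ ∀ β ∈ B,
      Qhat M P β₀ n (fun i => O i ω) (βhat n ω) (γhat n ω) (ξhat n ω) ≤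
        Qhat M P β₀ n (fun i => O i ω) β (γhat n ω) (ξhat n ω))
    (hcorrect : PropensityCorrect M P γs ∨ OutcomeCorrect M P β₀ B ξs)
    (hθlim : TendstoInMeasure Pr (fun n ω => stack (βhat n ω) (γhat n ω) (ξhat n ω)) atTop
      fun _ => stack β₀ γs ξs)
    (hγeq : EventuallyLikely Pr
      (fun n ω => ∑ i ∈ Finset.range n, obsMGamma M (O i ω) (γhat n ω) = 0))
    (hξeq : EventuallyLikely Pr
      (fun n ω => ∑ i ∈ Finset.range n, obsMXi M (O i ω) (ξhat n ω) = 0)) :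
    EventuallyLikely Pr fun n ω => empiricalMean (O · ω) n
      (fun a => phiTilde M P β₀ a (stack (βhat n ω) (γhat n ω) (ξhat n ω))) = 0 := by
  have hmean₀ : TendstoInMeasure Pr (fun n ω => empiricalMean (O · ω) n
      fun a => phiTilde M P β₀ a (stack β₀ γs ξs)) atTop fun _ => 0 :=
    tendstoInMeasure_const_iff_eventuallyLikely.2 fun ε hε => by
      simpa only [hN.mean_zero] using eventuallyLikely_empiricalMean hlaw hindep
        (hN.second_moment.integrable one_le_two) hε
  refine (hN.hasAsymptoticStrictFDeriv hlaw hindep).eventuallyLikely_eq_zero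
    (Linv := invExpJacobian M P β₀ γs ξs)
    (toEuclideanCLM_apply_nonsing_inv hN.isUnit_expJacobian) hmean₀ hθlim
    (mem_interior_iff_mem_nhds.1 hN.interior_mem)
    ((hβhat.and (hγeq.and hξeq)).mono' fun n ω ⟨⟨_, hmin⟩, hγ, hξ⟩ hB => ?_)
  exact hN.norm_empiricalMean_phiTilde_le_newtonStep (o := (O · ω)) (β := βhat n ω) hMAR hcorrect
    (A := fun θ => empiricalMean (O · ω) n fun a => phiTilde M P β₀ a θ) rfl
    (by rw [empiricalMean, hγ, smul_zero]) (by rw [empiricalMean, hξ, smul_zero]) hmin hB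

theorem tendstoInDistribution [IsProbabilityMeasure Pr] [IsFiniteMeasure P]
    (hN : NormalityConditions M P β₀ γs ξs B) (hlaw : ∀ i, HasLaw (O i) P Pr)
    (hindep : iIndepFun O Pr) (hMAR : MissingAtRandom P)
    (hβmeas : ∀ n, AEMeasurable (βhat n) Pr)
    (hβhat : EventuallyLikely Pr fun n ω => βhat n ω ∈ B ∧ ∀ β ∈ B,
      Qhat M P β₀ n (fun i => O i ω) (βhat n ω) (γhat n ω) (ξhat n ω) ≤
        Qhat M P β₀ n (fun i => O i ω) β (γhat n ω) (ξhat n ω))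
    (hγlim : TendstoInMeasure Pr γhat atTop fun _ => γs)
    (hξlim : TendstoInMeasure Pr ξhat atTop fun _ => ξs)
    (hcorrect : PropensityCorrect M P γs ∨ OutcomeCorrect M P β₀ B ξs)
    (hβlim : TendstoInMeasure Pr βhat atTop fun _ => β₀)
    (hγeq : EventuallyLikely Pr
      (fun n ω => ∑ i ∈ Finset.range n, obsMGamma M (O i ω) (γhat n ω) = 0))
    (hξeq : EventuallyLikely Pr
      (fun n ω => ∑ i ∈ Finset.range n, obsMXi M (O i ω) (ξhat n ω) = 0)) :
    TendstoInDistribution (fun (n : ℕ) ω => √n • (βhat n ω - β₀)) atTop id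
      (fun _ => Pr) (multivariateGaussian 0 (asymptoticVariance M P β₀ γs ξs)) := by
  have hpair : Pairwise fun i j => IndepFun (O i) (O j) Pr := fun i j hij => hindep.indepFun hij
  have hθlim := tendstoInMeasure_stack hβlim hγlim hξlim
  have hlin := (hN.hasAsymptoticStrictFDeriv hlaw hpair).tendstoInMeasure_linearization
    (Linv := invExpJacobian M P β₀ γs ξs)
    (toEuclideanCLM_nonsing_inv_apply hN.isUnit_expJacobian) hθlim
    (hN.eventuallyLikely_empiricalMean_eq_zero hlaw hpair hMAR hβhat hcorrect hθlim hγeq hξeq)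
    (tendstoInDistribution_sqrt_smul_empiricalMean hlaw hindep hN.second_moment hN.mean_zero)
  let T : Theta p q →L[ℝ] Vec 2 := -(betaCLM p q).comp (invExpJacobian M P β₀ γs ξs)
  have hinfluence : influence M P β₀ γs ξs = fun o => T (phiTilde M P β₀ o (stack β₀ γs ξs)) :=
    funext (hN.influence_eq hMAR hcorrect)
  have hmem : MemLp (influence M P β₀ γs ξs) 2 P :=
    hinfluence ▸ hN.second_moment.continuousLinearMap_comp T
  have hmean : ∫ o, influence M P β₀ γs ξs o ∂P = 0 := by
    rw [hinfluence, T.integral_comp_comm (hN.second_moment.integrable one_le_two), hN.mean_zero,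
      map_zero]
  have hsplit (n : ℕ) (ω : Ω) :
      √n • (βhat n ω - β₀) - √n • empiricalMean (O · ω) n (influence M P β₀ γs ξs)
        = betaPart (√n • (stack (βhat n ω) (γhat n ω) (ξhat n ω) - stack β₀ γs ξs
          + invExpJacobian M P β₀ γs ξs (empiricalMean (O · ω) n fun a =>
              phiTilde M P β₀ a (stack β₀ γs ξs)))) := by
    rw [hinfluence, empiricalMean_clm_comp, ← smul_sub]
    exact congrArg (√n • ·) (sub_neg_eq_add _ _)
  refine tendstoInDistribution_of_tendstoInMeasure_sub _ _
    (tendstoInDistribution_sqrt_smul_empiricalMean hlaw hindep hmem hmean)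
    (tendstoInMeasure_const_iff_eventuallyLikely (c := (0 : Vec 2)).2 fun ε hε => ?_)
    fun n => ((hβmeas n).sub_const β₀).fun_const_smul _
  refine (tendstoInMeasure_const_iff_eventuallyLikely.1 hlin ε hε).mono' fun n ω h => ?_
  rw [sub_zero] at h ⊢
  exact (hsplit n ω ▸ norm_betaPart_le _).trans_lt h

end NormalityConditions

end AsymptoticNormality

end RobustAIPW

open RobustAIPW in
theorem proposition2 {d p q : ℕ} {Ω : Type*} [MeasurableSpace Ω]
    (Pr : Measure Ω) [IsProbabilityMeasure Pr]
    (P : Measure (Obs d)) [IsProbabilityMeasure P]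
    -- the sample: i.i.d. with law `P`, outcomes missing at random
    (O : ℕ → Ω → Obs d) (hlaw : ∀ i, HasLaw (O i) P Pr) (hindep : iIndepFun O Pr)
    (hMAR : MissingAtRandom P)
    -- working models, estimating functions, parameter space of `(μ, σ)`, true and limit values
    (M : Ingredients d p q) (B : Set (Vec 2)) (hB : ∀ β ∈ B, 0 < β 1)
    (β₀ : Vec 2) (γs : Vec p) (ξs : Vec q)
    -- the estimators
    (γhat : ℕ → Ω → Vec p) (ξhat : ℕ → Ω → Vec q) (βhat : ℕ → Ω → Vec 2)
    (hγmeas : ∀ n, AEMeasurable (γhat n) Pr) (hξmeas : ∀ n, AEMeasurable (ξhat n) Pr)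
    (hβmeas : ∀ n, AEMeasurable (βhat n) Pr)
    (hβhat : EventuallyLikely Pr fun n ω => βhat n ω ∈ B ∧ ∀ β ∈ B,
      Qhat M P β₀ n (fun i => O i ω) (βhat n ω) (γhat n ω) (ξhat n ω) ≤
        Qhat M P β₀ n (fun i => O i ω) β (γhat n ω) (ξhat n ω))
    (hγlim : TendstoInMeasure Pr γhat atTop fun _ => γs)
    (hξlim : TendstoInMeasure Pr ξhat atTop fun _ => ξs)
    -- at least one of the two models is correctly specified
    (hcorrect : PropensityCorrect M P γs ∨ OutcomeCorrect M P β₀ B ξs) :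
    (ConsistencyConditions M P β₀ γs ξs B → TendstoInMeasure Pr βhat atTop fun _ => β₀) ∧
    (TendstoInMeasure Pr βhat atTop (fun _ => β₀) →
      EventuallyLikely Pr
        (fun n ω => ∑ i ∈ Finset.range n, obsMGamma M (O i ω) (γhat n ω) = 0) →
      EventuallyLikely Pr
        (fun n ω => ∑ i ∈ Finset.range n, obsMXi M (O i ω) (ξhat n ω) = 0) →
      NormalityConditions M P β₀ γs ξs B →
      TendstoInDistribution (fun (n : ℕ) ω => Real.sqrt n • (βhat n ω - β₀)) atTop id
        (fun _ => Pr) (multivariateGaussian 0 (asymptoticVariance M P β₀ γs ξs))) := by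
  refine ⟨fun hC => hC.tendstoInMeasure hlaw (fun i j hij => hindep.indepFun hij) hMAR hβhat
    hγlim hξlim hcorrect, fun hβlim hγeq hξeq hN => ?_⟩
  exact hN.tendstoInDistribution hlaw hindep hMAR hβmeas hβhat hγlim hξlim hcorrect hβlim hγeq hξeq
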